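/- Let $K$ be a nonarchimedean local field of characteristic zero with ring of integers $\mathcal{O}_K$, let $\mathfrak{p}$ be its maximal ideal and let $q$ be the cardinality of its residue field. Let $L$ be a reduced commutative $K$-algebra of dimension $2$ over $K$, and let $\mathcal{O}_L$ be the integral closure of $\mathcal{O}_K$ in $L$. Let $\mathscr{B}$ be the Bruhat–Tits tree of $\mathrm{SL}(L)\cong \mathrm{SL}(2,K)$: its vertices are the homothety classes $[\Lambda]$ of $\mathcal{O}_K$-lattices $\Lambda\subset L$ of rank $2$, and two vertices are adjacent if they have representatives with $\mathfrak{p}\Lambda\subsetneq\Lambda'\subsetneq\Lambda$. For a set $\mathscr{P}$ of vertices (the basin) put $\mathscr{P}_0=\mathscr{P}$, $\mathscr{P}_{n}=\{v : d(v,\mathscr{P}_{n-1})\le 1\}$ for $n\ge 1$, and $\mathscr{R}_0=\mathscr{P}$, $\mathscr{R}_n=\mathscr{P}_n\setminus\mathscr{P}_{n-1}$ for $n\ge 1$. Then $L/K$ is a ramified quadratic field extension, or an unramified quadratic field extension, or split, i.e. $L\cong K\times K$ as a $K$-algebra; and there is $\Delta\in\mathcal{O}_L$ with $\mathcal{O}_L=\mathcal{O}_K[\Delta]$.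 Moreover, let $p$ be any uniformizer of $K$ and $\Delta$ any element with $\mathcal{O}_L=\mathcal{O}_K[\Delta]$, put $\mathcal{O}_n=\mathcal{O}_K[p^n\Delta]$ for $n\ge 0$, and define the basin as follows: 1. ramified case: $\mathscr{P}=\{[\mathcal{O}_L],[\pi\mathcal{O}_L]\}$, where $\pi$ is any uniformizer of $L$; 2. unramified case: $\mathscr{P}=\{[\mathcal{O}_L]\}$; 3. split case: $\mathscr{P}=\{[(1,0)\mathcal{O}_K\oplus(0,p^m)\mathcal{O}_K] : m\in\mathbb{Z}\}$, where $L$ is identified with $K\times K$ by any isomorphism of $K$-algebras. Then $\mathscr{B}$ is a homogeneous tree of degree $q+1$, and $\mathscr{P}$ consists of the two ends of an edge in case 1, of a single vertex in case 2, and of the vertices of an apartment (a subgraph that is a line with vertices indexed by $\mathbb{Z}$) in case 3, so that $(\mathscr{B},\mathscr{P})$ is the ramified, unramified or split impacted building of degree $q+1$, respectively. In each case, for every $n\ge 0$ and every vertex $v$ of $\mathscr{B}$: there is a principal ideal $I$ of $\mathcal{O}_n$, of rank $2$ as an $\mathcal{O}_K$-module, with $v=[I]$, if and only if $v\in\mathscr{R}_n$.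 -/

import Mathlib

open scoped ValuativeRel Pointwise

noncomputable section

/-! ### Impacted buildings of type `Ã₁` -/

section ImpactedBuildings

variable {V : Type*}

/-- The filtration `P = P₀ ⊆ P₁ ⊆ P₂ ⊆ ⋯` around the basin `P`:
`Pₙ₊₁` is the set of vertices at distance at most one from `Pₙ`. -/
def basinFiltration (G : SimpleGraph V) (P : Set V) : ℕ → Set V
  | 0 => P
  | n + 1 => {v | ∃ w ∈ basinFiltration G P n, G.edist v w ≤ 1}

/-- The layers around the basin: `R₀ = P` and `Rₙ = Pₙ \ Pₙ₋₁` for `n ≥ 1`. -/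
def layer (G : SimpleGraph V) (P : Set V) : ℕ → Set V
  | 0 => P
  | n + 1 => basinFiltration G P (n + 1) \ basinFiltration G P n

/-- `G` is the homogeneous tree of degree `m + 1`. -/
def IsHomogeneousTree (G : SimpleGraph V) (m : ℕ) : Prop :=
  G.IsTree ∧ ∀ v, (G.neighborSet v).encard = m + 1

/-- `(G, P)` is the unramified impacted building of degree `m + 1`: the basin is a vertex. -/
def IsUnramifiedImpactedBuilding (G : SimpleGraph V) (P : Set V) (m : ℕ) : Prop :=
  IsHomogeneousTree G m ∧ ∃ v, P = {v}

/-- `(G, P)` is the ramified impacted building of degree `m + 1`: the basin is an edge. -/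
def IsRamifiedImpactedBuilding (G : SimpleGraph V) (P : Set V) (m : ℕ) : Prop :=
  IsHomogeneousTree G m ∧ ∃ v w, G.Adj v w ∧ P = {v, w}

/-- `(G, P)` is the split impacted building of degree `m + 1`: the basin is an apartment,
that is, a copy of the real line with its vertices at the integers. -/
def IsSplitImpactedBuilding (G : SimpleGraph V) (P : Set V) (m : ℕ) : Prop :=
  IsHomogeneousTree G m ∧
    ∃ f : ℤ → V, Function.Injective f ∧ (∀ i, G.Adj (f i) (f (i + 1))) ∧ P = Set.range f

end ImpactedBuildings

/-! ### The Bruhat–Tits tree -/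

section Tree

variable (K : Type*) [Field K] [ValuativeRel K] [TopologicalSpace K] [IsNonarchimedeanLocalField K]
variable (V : Type*) [AddCommGroup V] [Module K V]

/-- The homothety relation on the `𝒪[K]`-lattices of `V`: `Λ' = c Λ` for some `c ≠ 0` in `K`. -/
def homothety : Setoid {Λ : Submodule 𝒪[K] V // Λ.IsLattice K} where
  r Λ Λ' := ∃ c : K, c ≠ 0 ∧ Λ'.1 = c • Λ.1
  iseqv :=
    { refl := fun _ => ⟨1, one_ne_zero, (one_smul _ _).symm⟩
      symm := by
        rintro Λ Λ' ⟨c, hc, h⟩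
        exact ⟨c⁻¹, inv_ne_zero hc, by rw [h, smul_smul, inv_mul_cancel₀ hc, one_smul]⟩
      trans := by
        rintro Λ Λ' Λ'' ⟨c, hc, h⟩ ⟨d, hd, h'⟩
        exact ⟨d * c, mul_ne_zero hd hc, by rw [h', h, mul_smul]⟩ }

/-- The vertices of the Bruhat–Tits tree of `SL(V)`, for a plane `V` over `K`: the homothety
classes of `𝒪[K]`-lattices in `V`. -/
def TreeVertex : Type _ := Quotient (homothety K V)

variable {K V}

/-- `M` is a lattice and `v` is its homothety class. -/
def TreeVertex.IsClassOf (v : TreeVertex K V) (M : Submodule 𝒪[K] V) : Prop :=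
  ∃ h : M.IsLattice K, v = Quotient.mk (homothety K V) ⟨M, h⟩

theorem TreeVertex.IsClassOf.smul {v : TreeVertex K V} {M : Submodule 𝒪[K] V}
    (h : v.IsClassOf M) {c : K} (hc : c ≠ 0) : v.IsClassOf (c • M) := by
  obtain ⟨hM, rfl⟩ := h
  exact ⟨Submodule.IsLattice.smul K M (Units.mk0 c hc), Quotient.sound ⟨c, hc, rfl⟩⟩

theorem TreeVertex.IsClassOf.exists_smul {v : TreeVertex K V} {M N : Submodule 𝒪[K] V}
    (h : v.IsClassOf M) (h' : v.IsClassOf N) : ∃ c : K, c ≠ 0 ∧ N = c • M := by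
  obtain ⟨hM, rfl⟩ := h
  obtain ⟨hN, e⟩ := h'
  exact Quotient.exact e

theorem maximalIdeal_smul_eq {p : 𝒪[K]} (hp : Irreducible p) (M : Submodule 𝒪[K] V) :
    𝓂[K] • M = (p : K) • M := by
  rw [hp.maximalIdeal_eq, Submodule.ideal_span_singleton_smul]
  rfl

variable (K V)

/-- The Bruhat–Tits tree of `SL(V)`: two vertices are adjacent when they are the classes of
lattices `Λ` and `Λ'` with `𝔭 Λ ⊊ Λ' ⊊ Λ`, where `𝔭` is the maximal ideal of `𝒪[K]`. -/
def bruhatTitsTree : SimpleGraph (TreeVertex K V) where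
  Adj v w := ∃ Λ Λ' : Submodule 𝒪[K] V,
    v.IsClassOf Λ ∧ w.IsClassOf Λ' ∧ 𝓂[K] • Λ < Λ' ∧ Λ' < Λ
  symm := by
    constructor
    rintro v w ⟨Λ, Λ', hv, hw, h1, h2⟩
    obtain ⟨p, hp⟩ := IsDiscreteValuationRing.exists_irreducible 𝒪[K]
    have hp0 : (p : K) ≠ 0 := fun h => hp.ne_zero (Subtype.ext h)
    refine ⟨Λ', 𝓂[K] • Λ, hw, ?_, ?_, h1⟩
    · rw [maximalIdeal_smul_eq hp]
      exact hv.smul hp0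
    · rw [maximalIdeal_smul_eq hp, maximalIdeal_smul_eq hp]
      refine lt_of_le_of_ne (smul_mono_right _ h2.le) fun h => h2.ne ?_
      have h' := congrArg (fun M : Submodule 𝒪[K] V => (p : K)⁻¹ • M) h
      simpa only [smul_smul, inv_mul_cancel₀ hp0, one_smul] using h'
  loopless := by
    constructor
    rintro v ⟨Λ, Λ', hv, hw, h1, h2⟩
    obtain ⟨c, hc0, rfl⟩ := hv.exists_smul hw
    rcases le_or_gt 1 (ValuativeRel.valuation K c) with hc | hc
    · have hc' : ValuativeRel.valuation K c⁻¹ ≤ 1 := by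
        rw [map_inv₀]
        exact inv_le_one_of_one_le₀ hc
      refine h2.not_ge fun x hx => ?_
      have hx' : c⁻¹ • x ∈ Λ := Λ.smul_mem (⟨_, hc'⟩ : 𝒪[K]) hx
      simpa [smul_smul, hc0] using Submodule.smul_mem_pointwise_smul _ c _ hx'
    · refine h1.not_ge fun x hx => ?_
      obtain ⟨y, hy, rfl⟩ := (Submodule.mem_smul_pointwise_iff_exists _ _ _).1 hx
      have hm : (⟨c, hc.le⟩ : 𝒪[K]) ∈ 𝓂[K] := by
        rw [IsLocalRing.mem_maximalIdeal, mem_nonunits_iff,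
          (Valuation.integer.integers (ValuativeRel.valuation K)).isUnit_iff_valuation_eq_one]
        exact hc.ne
      exact Submodule.smul_mem_smul hm hy

end Tree

/-! ### The main sequence of orders, its ideals, and the three basins -/

section Orders

variable (K : Type*) [Field K] [ValuativeRel K] [TopologicalSpace K] [IsNonarchimedeanLocalField K]
variable (L : Type*) [CommRing L] [Algebra K L]

/-- The ring of integers of `L`: the integral closure of `𝒪[K]` in `L`. -/
abbrev integers : Subalgebra 𝒪[K] L := integralClosure 𝒪[K] L

/-- `L` is a field and `L/K` is unramified: the ramification index is `1`. -/
def IsUnramifiedCase : Prop :=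
  IsField L ∧ ∀ P : Ideal (integers K L), P.IsMaximal → Ideal.ramificationIdx' 𝓂[K] P = 1

/-- `L` is a field and `L/K` is ramified: the ramification index is greater than `1`. -/
def IsRamifiedCase : Prop :=
  IsField L ∧ ∀ P : Ideal (integers K L), P.IsMaximal → 1 < Ideal.ramificationIdx' 𝓂[K] P

/-- `L` is isomorphic to `K × K`. -/
def IsSplitCase : Prop := Nonempty (L ≃ₐ[K] K × K)

variable {K L}

/-- The order `𝒪ₙ = 𝒪[K][pⁿ Δ]`. -/
def mainOrder (p : 𝒪[K]) (Δ : L) (n : ℕ) : Subalgebra 𝒪[K] L :=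
  Algebra.adjoin 𝒪[K] {p ^ n • Δ}

/-- An ideal of a subring `O` of `L`, seen as an `𝒪[K]`-submodule of `L`. -/
def idealToSubmodule {O : Subalgebra 𝒪[K] L} (I : Ideal O) : Submodule 𝒪[K] L :=
  (I.restrictScalars 𝒪[K]).map O.val.toLinearMap

/-- The vertex `v` represents a principal ideal of `O` of rank two over `𝒪[K]`. -/
def RepresentsPrincipalIdeal (O : Subalgebra 𝒪[K] L) (v : TreeVertex K L) : Prop :=
  ∃ I : Ideal O, I.IsPrincipal ∧ Module.finrank 𝒪[K] I = 2 ∧ v.IsClassOf (idealToSubmodule I)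

variable (K L) in
/-- The basin in the unramified case: the class of `𝒪_L`. -/
def unramifiedBasin : Set (TreeVertex K L) :=
  {v | v.IsClassOf (Subalgebra.toSubmodule (integers K L))}

/-- The basin in the ramified case: the classes of `𝒪_L` and of `π 𝒪_L`. -/
def ramifiedBasin (π : integers K L) : Set (TreeVertex K L) :=
  {v | v.IsClassOf (Subalgebra.toSubmodule (integers K L)) ∨
    v.IsClassOf (idealToSubmodule (Ideal.span {π}))}

/-- The basin in the split case: the classes of the lattices `(1, 0) 𝒪[K] ⊕ (0, pᵐ) 𝒪[K]` for
`m ∈ ℤ`, where `L` is identified with `K × K` by `e`. -/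
def splitBasin (p : 𝒪[K]) (e : L ≃ₐ[K] K × K) : Set (TreeVertex K L) :=
  {v | ∃ m : ℤ, v.IsClassOf (Submodule.span 𝒪[K] {e.symm (1, 0), e.symm (0, (p : K) ^ m)})}

end Orders

end

/-!
The proof sorts the vertices of the tree by their multiplier rings. Let `𝒪_L = 𝒪[K] + 𝒪[K] Δ` and
`𝒪ₙ = 𝒪[K] + 𝒪[K] pⁿ Δ`. A vertex has level `n` if its lattices are stable under `𝒪ₙ`, with `n`
minimal (`TreeVertex.HasLevel`).

A lattice `Λ` of level `n` is `x 𝒪ₙ` for a unit `x` of `L`. Indeed `pⁿ Δ` is not a scalar `c` on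
`Λ / pΛ`, since otherwise `Λ` would be stable under the integral element `p⁻¹ (pⁿ Δ - c)`, and the
level would drop. An endomorphism of a lattice of rank two that is not a scalar modulo `p` has a
cyclic vector (`exists_isFrame_apply`), and this vector is `x`. Hence the principal ideals of `𝒪ₙ`
of rank two represent exactly the vertices of level `n` (`representsPrincipalIdeal_iff_hasLevel`).

If `Λ` and `Λ'` represent adjacent vertices, with `pΛ ⊆ Λ' ⊆ Λ`, then stability of `Λ` under `α`
implies stability of `Λ'` under `pα`, so the level changes by at most one along an edge. Conversely
`[x 𝒪ₙ₊₁]` is adjacent to `[x 𝒪ₙ]`. So the vertices of level at most `n` are those within distance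
`n` of the vertices of level zero (`basinFiltration_eq_stableVertices`), and it remains to identify
the classes `[x 𝒪_L]` with the basin. In the field case `𝒪_L` is a discrete valuation ring with
uniformizer `ϖ`; this is obtained from Hensel's lemma for the polynomial `Y² - Y + c`
(`isDiscreteValuationRing_integers`). Then `p` is a unit times `ϖ` or `ϖ²`, and the classes are
those of `𝒪_L`, or of `𝒪_L` and `ϖ 𝒪_L` (`mem_stableVertices_iff_exists_pow`). In the split case they are
the classes of `𝒪[K] ⊕ pᵐ 𝒪[K]` (`splitBasin_eq_stableVertices`).

The graph is a tree by a height argument (`SimpleGraph.isTree_of_height`). Relative to a lattice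
`M`, every vertex is the class of some `𝒪[K] u + pᵏ M` with `u ∈ M ∖ pM`; among its neighbours only
the class of `𝒪[K] u + pᵏ⁻¹ M` has smaller height, and all the others have height `k + 1`
(`hasHeight_succ_or_eq`). The neighbours of `[M]` correspond to the lines of `M / pM`, which gives
the degree `q + 1` (`encard_neighborSet`).
-/

noncomputable section

/-! ### Lattices in a plane -/

section Lattices

variable {K : Type*} [Field K] [ValuativeRel K] [TopologicalSpace K] [IsNonarchimedeanLocalField K]
variable {V : Type*} [AddCommGroup V] [Module K V]

set_option linter.unusedSectionVars false

theorem coe_ne_zero_of_irreducible {p : 𝒪[K]} (hp : Irreducible p) : (p : K) ≠ 0 :=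
  fun h => hp.ne_zero (Subtype.ext h)

theorem exists_zpow_mul_unit {p : 𝒪[K]} (hp : Irreducible p) {c : K} (hc : c ≠ 0) :
    ∃ (n : ℤ) (u : 𝒪[K]ˣ), c = (p : K) ^ n * ((u : 𝒪[K]) : K) := by
  obtain ⟨n, u, h⟩ := IsDiscreteValuationRing.exists_units_eq_smul_zpow_of_irreducible hp hc
  exact ⟨n, u, h.trans (mul_comm _ _)⟩

theorem isUnit_of_not_dvd {p : 𝒪[K]} (hp : Irreducible p) {a : 𝒪[K]} (h : ¬ p ∣ a) :
    IsUnit a := by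
  rw [← IsLocalRing.notMem_maximalIdeal, hp.maximalIdeal_eq, Ideal.mem_span_singleton]
  exact h

theorem mem_smul_iff {c : K} (hc : c ≠ 0) {M : Submodule 𝒪[K] V} {x : V} :
    x ∈ c • M ↔ c⁻¹ • x ∈ M := by
  rw [Submodule.mem_smul_pointwise_iff_exists]
  constructor
  · rintro ⟨y, hy, rfl⟩
    rwa [inv_smul_smul₀ hc]
  · exact fun h => ⟨_, h, smul_inv_smul₀ hc x⟩

theorem mem_pow_smul_iff (p : 𝒪[K]) (k : ℕ) {M : Submodule 𝒪[K] V} {x : V} :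
    x ∈ ((p : K) ^ k) • M ↔ ∃ y ∈ M, p ^ k • y = x := by
  rw [Submodule.mem_smul_pointwise_iff_exists]
  rfl

theorem mem_coe_smul_iff (p : 𝒪[K]) {M : Submodule 𝒪[K] V} {x : V} :
    x ∈ (p : K) • M ↔ ∃ y ∈ M, p • y = x := by
  rw [Submodule.mem_smul_pointwise_iff_exists]
  rfl

theorem coe_smul_le (a : 𝒪[K]) (M : Submodule 𝒪[K] V) : (a : K) • M ≤ M := by
  intro x hx
  obtain ⟨y, hy, rfl⟩ := (mem_coe_smul_iff a).1 hx
  exact M.smul_mem a hy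

theorem pow_smul_anti (p : 𝒪[K]) (M : Submodule 𝒪[K] V) {j k : ℕ} (h : j ≤ k) :
    ((p : K) ^ k) • M ≤ ((p : K) ^ j) • M := by
  obtain ⟨i, rfl⟩ := Nat.exists_eq_add_of_le h
  rw [pow_add, mul_smul]
  exact smul_mono_right _ (coe_smul_le (p ^ i) M)

theorem unit_smul_eq (u : 𝒪[K]ˣ) (M : Submodule 𝒪[K] V) : ((u : 𝒪[K]) : K) • M = M := by
  refine le_antisymm (coe_smul_le _ M) fun x hx =>
    (mem_coe_smul_iff _).2 ⟨_, M.smul_mem (↑u⁻¹) hx, ?_⟩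
  rw [smul_smul, Units.mul_inv, one_smul]

theorem smul_le_smul_iff_of_ne_zero {c : K} (hc : c ≠ 0) {M N : Submodule 𝒪[K] V} :
    c • M ≤ c • N ↔ M ≤ N := by
  refine ⟨fun h x hx => ?_, fun h => smul_mono_right _ h⟩
  have := h (Submodule.smul_mem_pointwise_smul x c M hx)
  rwa [mem_smul_iff hc, inv_smul_smul₀ hc] at this

theorem smul_lt_smul_iff_of_ne_zero {c : K} (hc : c ≠ 0) {M N : Submodule 𝒪[K] V} :
    c • M < c • N ↔ M < N := by
  simp only [lt_iff_le_not_ge, smul_le_smul_iff_of_ne_zero hc]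

theorem TreeVertex.exists_isClassOf (v : TreeVertex K V) :
    ∃ M : Submodule 𝒪[K] V, v.IsClassOf M := by
  obtain ⟨⟨M, hM⟩, rfl⟩ := Quotient.exists_rep v
  exact ⟨M, hM, rfl⟩

theorem exists_treeVertex_isClassOf {M : Submodule 𝒪[K] V} (hM : M.IsLattice K) :
    ∃ v : TreeVertex K V, v.IsClassOf M := ⟨Quotient.mk _ ⟨M, hM⟩, hM, rfl⟩

theorem TreeVertex.IsClassOf.isLattice {v : TreeVertex K V} {M : Submodule 𝒪[K] V}
    (h : v.IsClassOf M) : M.IsLattice K := h.1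

theorem TreeVertex.IsClassOf.eq {v w : TreeVertex K V} {M : Submodule 𝒪[K] V}
    (h : v.IsClassOf M) (h' : w.IsClassOf M) : v = w := by
  obtain ⟨_, rfl⟩ := h
  obtain ⟨_, rfl⟩ := h'
  rfl

theorem TreeVertex.IsClassOf.of_smul {v : TreeVertex K V} {M : Submodule 𝒪[K] V} {c : K}
    (hc : c ≠ 0) (h : v.IsClassOf (c • M)) : v.IsClassOf M := by
  simpa only [smul_smul, inv_mul_cancel₀ hc, one_smul] using h.smul (inv_ne_zero hc)

/-- Homotheties may be taken to be integral powers of a uniformizer. -/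
theorem TreeVertex.IsClassOf.exists_zpow_smul {p : 𝒪[K]} (hp : Irreducible p)
    {v : TreeVertex K V} {M N : Submodule 𝒪[K] V}
    (h : v.IsClassOf M) (h' : v.IsClassOf N) : ∃ n : ℤ, N = ((p : K) ^ n) • M := by
  obtain ⟨c, hc, rfl⟩ := h.exists_smul h'
  obtain ⟨n, u, rfl⟩ := exists_zpow_mul_unit hp hc
  exact ⟨n, by rw [mul_smul, unit_smul_eq]⟩

/-- Adjacency may be tested on any lattice that represents the first vertex. -/
theorem adj_iff_exists_lattice {p : 𝒪[K]} (hp : Irreducible p) {v w : TreeVertex K V}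
    {M : Submodule 𝒪[K] V} (hv : v.IsClassOf M) :
    (bruhatTitsTree K V).Adj v w ↔ ∃ N, w.IsClassOf N ∧ (p : K) • M < N ∧ N < M := by
  constructor
  · rintro ⟨Λ, Λ', h, hw, h1, h2⟩
    obtain ⟨c, hc, rfl⟩ := h.exists_smul hv
    refine ⟨c • Λ', hw.smul hc, ?_, (smul_lt_smul_iff_of_ne_zero hc).2 h2⟩
    rw [smul_smul, mul_comm, mul_smul]
    rw [maximalIdeal_smul_eq hp] at h1
    exact (smul_lt_smul_iff_of_ne_zero hc).2 h1
  · rintro ⟨N, hw, h1, h2⟩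
    exact ⟨M, N, hv, hw, by rwa [maximalIdeal_smul_eq hp], h2⟩

/-- `u` and `w` are linearly independent over `K` and generate the `𝒪[K]`-module `M`. In a plane,
the modules with a frame are the lattices. -/
structure IsFrame (u w : V) (M : Submodule 𝒪[K] V) : Prop where
  linearIndependent : LinearIndependent K ![u, w]
  eq_span : M = Submodule.span 𝒪[K] {u, w}

namespace IsFrame

variable {u w : V} {M : Submodule 𝒪[K] V}

theorem mem_iff (h : IsFrame u w M) {x : V} : x ∈ M ↔ ∃ a b : 𝒪[K], a • u + b • w = x := by
  rw [h.eq_span, Submodule.mem_span_pair]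

theorem left_mem (h : IsFrame u w M) : u ∈ M := h.mem_iff.2 ⟨1, 0, by simp⟩

theorem right_mem (h : IsFrame u w M) : w ∈ M := h.mem_iff.2 ⟨0, 1, by simp⟩

theorem ext (h : IsFrame u w M) {a b a' b' : 𝒪[K]} (e : a • u + b • w = a' • u + b' • w) :
    a = a' ∧ b = b' := by
  have := h.linearIndependent.eq_of_pair (s := (a : K)) (t := b) (s' := a') (t' := b') e
  exact ⟨Subtype.ext this.1, Subtype.ext this.2⟩

theorem mem_pow_smul_iff (h : IsFrame u w M) (p : 𝒪[K]) (k : ℕ) {a b : 𝒪[K]} :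
    a • u + b • w ∈ ((p : K) ^ k) • M ↔ p ^ k ∣ a ∧ p ^ k ∣ b := by
  rw [_root_.mem_pow_smul_iff]
  constructor
  · rintro ⟨y, hy, e⟩
    obtain ⟨c, d, rfl⟩ := h.mem_iff.1 hy
    rw [smul_add, smul_smul, smul_smul] at e
    obtain ⟨rfl, rfl⟩ := h.ext e
    exact ⟨⟨c, rfl⟩, ⟨d, rfl⟩⟩
  · rintro ⟨⟨c, rfl⟩, ⟨d, rfl⟩⟩
    exact ⟨c • u + d • w, h.mem_iff.2 ⟨c, d, rfl⟩, by rw [smul_add, smul_smul, smul_smul]⟩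

theorem mem_smul_iff (h : IsFrame u w M) (p : 𝒪[K]) {a b : 𝒪[K]} :
    a • u + b • w ∈ (p : K) • M ↔ p ∣ a ∧ p ∣ b := by
  simpa only [pow_one] using h.mem_pow_smul_iff p 1

theorem symm (h : IsFrame u w M) : IsFrame w u M :=
  ⟨LinearIndependent.pair_symm_iff.1 h.linearIndependent, by rw [h.eq_span, Set.pair_comm]⟩

theorem span_eq_top (hV : Module.finrank K V = 2) (h : IsFrame u w M) :
    Submodule.span K {u, w} = ⊤ := by
  have : FiniteDimensional K V := Module.finite_of_finrank_eq_succ hV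
  have := h.linearIndependent.span_eq_top_of_card_eq_finrank' (by simp [hV])
  rwa [Matrix.range_cons, Matrix.range_cons, Matrix.range_empty, Set.union_empty,
    Set.singleton_union] at this

theorem isLattice (hV : Module.finrank K V = 2) (h : IsFrame u w M) : M.IsLattice K := by
  refine ⟨h.eq_span ▸ Submodule.fg_span (Set.toFinite _), ?_⟩
  rw [eq_top_iff, ← h.span_eq_top hV]
  refine Submodule.span_mono ?_
  rintro x (rfl | rfl)
  exacts [h.left_mem, h.right_mem]

end IsFrame

/-- In a plane, two generators of a lattice are linearly independent. -/
theorem isFrame_of_span_eq (hV : Module.finrank K V = 2) {M : Submodule 𝒪[K] V}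
    (hM : M.IsLattice K) {u w : V} (h : M = Submodule.span 𝒪[K] {u, w}) : IsFrame u w M := by
  refine ⟨linearIndependent_of_top_le_span_of_card_eq_finrank ?_ (by simp [hV]), h⟩
  rw [← hM.span_eq_top, h, Submodule.span_span_of_tower, Matrix.range_cons, Matrix.range_cons,
    Matrix.range_empty, Set.union_empty, Set.singleton_union]

theorem exists_isFrame (hV : Module.finrank K V = 2) {M : Submodule 𝒪[K] V}
    (hM : M.IsLattice K) : ∃ u w, IsFrame u w M := by
  have : Module.finrank 𝒪[K] M = 2 := by
    rw [Module.finrank, Submodule.IsLattice.rank' K M]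
    exact hV
  let b := Module.finBasisOfFinrankEq 𝒪[K] M this
  refine ⟨b 0, b 1, isFrame_of_span_eq hV hM ?_⟩
  have h := congrArg (Submodule.map M.subtype) b.span_eq
  rw [Submodule.map_span, Submodule.map_top, Submodule.range_subtype, ← Set.range_comp] at h
  refine h.symm.trans (congrArg _ ?_)
  ext x
  simp [Fin.exists_fin_two, eq_comm]

/-- The second vector of a frame may be changed by a unit and by a multiple of the first. -/
theorem IsFrame.smul_add_unit_smul (hV : Module.finrank K V = 2) {u w : V} {M : Submodule 𝒪[K] V}
    (h : IsFrame u w M) (a : 𝒪[K]) (b : 𝒪[K]ˣ) : IsFrame u (a • u + (b : 𝒪[K]) • w) M := by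
  refine isFrame_of_span_eq hV (h.isLattice hV) (le_antisymm ?_ ?_)
  · intro x hx
    obtain ⟨c, d, rfl⟩ := h.mem_iff.1 hx
    refine Submodule.mem_span_pair.2 ⟨c - d * ↑b⁻¹ * a, d * ↑b⁻¹, ?_⟩
    have : w = (↑b⁻¹ * ↑b : 𝒪[K]) • w := by rw [Units.inv_mul, one_smul]
    conv_rhs => rw [this]
    module
  · rw [Submodule.span_le]
    rintro x (rfl | rfl)
    exacts [h.left_mem, h.mem_iff.2 ⟨a, b, rfl⟩]

/-- A vector of a lattice `M` that is not in `pM` is the first vector of a frame. -/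
theorem exists_isFrame_left (hV : Module.finrank K V = 2) {p : 𝒪[K]} (hp : Irreducible p)
    {M : Submodule 𝒪[K] V} (hM : M.IsLattice K) {u : V} (hu : u ∈ M) (hu' : u ∉ (p : K) • M) :
    ∃ w, IsFrame u w M := by
  obtain ⟨e, f, h⟩ := exists_isFrame hV hM
  obtain ⟨a, b, rfl⟩ := h.mem_iff.1 hu
  wlog ha : ¬ p ∣ a generalizing a b e f
  · have hb : ¬ p ∣ b := fun hb => hu' ((h.mem_smul_iff p).2 ⟨not_not.1 ha, hb⟩)
    rw [add_comm] at hu hu' ⊢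
    exact this f e h.symm b a hu hu' hb
  obtain ⟨a, rfl⟩ := isUnit_of_not_dvd hp ha
  refine ⟨f, ?_⟩
  rw [add_comm]
  exact (h.symm.smul_add_unit_smul hV b a).symm

/-- The lattice `𝒪[K] u + pᵏ M`. For `u ∈ M ∖ pM` it is the preimage in `M` of the line that `u`
spans in `M / pᵏ M`. -/
def lineLattice (p : 𝒪[K]) (u : V) (k : ℕ) (M : Submodule 𝒪[K] V) : Submodule 𝒪[K] V :=
  Submodule.span 𝒪[K] {u} ⊔ ((p : K) ^ k) • M

theorem self_mem_lineLattice (p : 𝒪[K]) (u : V) (k : ℕ) (M : Submodule 𝒪[K] V) :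
    u ∈ lineLattice p u k M :=
  Submodule.mem_sup_left (Submodule.mem_span_singleton_self u)

theorem pow_smul_le_lineLattice (p : 𝒪[K]) (u : V) (k : ℕ) (M : Submodule 𝒪[K] V) :
    ((p : K) ^ k) • M ≤ lineLattice p u k M := le_sup_right

theorem lineLattice_anti (p : 𝒪[K]) (u : V) (M : Submodule 𝒪[K] V) {j k : ℕ} (h : j ≤ k) :
    lineLattice p u k M ≤ lineLattice p u j M :=
  sup_le_sup le_rfl (pow_smul_anti p M h)

theorem lineLattice_le (p : 𝒪[K]) {u : V} (k : ℕ) {M : Submodule 𝒪[K] V} (hu : u ∈ M) :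
    lineLattice p u k M ≤ M :=
  sup_le (by simpa using hu) (coe_smul_le (p ^ k) M)

theorem lineLattice_zero (p : 𝒪[K]) {u : V} {M : Submodule 𝒪[K] V} (hu : u ∈ M) :
    lineLattice p u 0 M = M :=
  le_antisymm (lineLattice_le p 0 hu) (by simpa using pow_smul_le_lineLattice p u 0 M)

theorem IsFrame.mem_lineLattice_iff {u w : V} {M : Submodule 𝒪[K] V} (h : IsFrame u w M)
    (p : 𝒪[K]) (k : ℕ) {a b : 𝒪[K]} : a • u + b • w ∈ lineLattice p u k M ↔ p ^ k ∣ b := by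
  constructor
  · intro hx
    obtain ⟨y, hy, z, hz, e⟩ := Submodule.mem_sup.1 hx
    obtain ⟨c, rfl⟩ := Submodule.mem_span_singleton.1 hy
    have : (a - c) • u + b • w ∈ ((p : K) ^ k) • M := by
      convert hz using 1
      rw [← add_right_inj (c • u), e]
      module
    exact ((h.mem_pow_smul_iff p k).1 this).2
  · intro hb
    refine Submodule.add_mem _ (Submodule.smul_mem _ _ (self_mem_lineLattice p u k M)) ?_
    refine pow_smul_le_lineLattice p u k M ?_
    simpa using (h.mem_pow_smul_iff p k (a := 0) (b := b)).2 ⟨dvd_zero _, hb⟩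

theorem IsFrame.lineLattice {u w : V} {M : Submodule 𝒪[K] V} (h : IsFrame u w M)
    {p : 𝒪[K]} (hp : Irreducible p) (k : ℕ) : IsFrame u (p ^ k • w) (lineLattice p u k M) := by
  refine ⟨?_, le_antisymm ?_ ?_⟩
  · have := h.linearIndependent
    rw [LinearIndependent.pair_iff] at this ⊢
    intro s t e
    have := this s (t * (p : K) ^ k) (by rw [mul_smul]; exact e)
    exact ⟨this.1, by simpa [coe_ne_zero_of_irreducible hp] using this.2⟩
  · intro x hx
    obtain ⟨a, b, rfl⟩ := h.mem_iff.1 (lineLattice_le p k h.left_mem hx)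
    obtain ⟨c, rfl⟩ := (h.mem_lineLattice_iff p k).1 hx
    exact Submodule.mem_span_pair.2 ⟨a, c, by module⟩
  · rw [Submodule.span_le]
    rintro x (rfl | rfl)
    · exact self_mem_lineLattice _ _ _ _
    · simpa using (h.mem_lineLattice_iff p k (a := 0) (b := p ^ k)).2 dvd_rfl

theorem IsFrame.left_notMem {u w : V} {M : Submodule 𝒪[K] V} (h : IsFrame u w M)
    {p : 𝒪[K]} (hp : Irreducible p) : u ∉ (p : K) • M := by
  intro hu
  have := (h.mem_smul_iff p (a := 1) (b := 0)).1 (by simpa using hu)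
  exact hp.not_isUnit (isUnit_of_dvd_one this.1)

variable (hV : Module.finrank K V = 2) {p : 𝒪[K]} (hp : Irreducible p)
include hV hp

theorem isLattice_lineLattice {M : Submodule 𝒪[K] V} (hM : M.IsLattice K) {u : V} (hu : u ∈ M)
    (hu' : u ∉ (p : K) • M) (k : ℕ) : (lineLattice p u k M).IsLattice K := by
  obtain ⟨w, h⟩ := exists_isFrame_left hV hp hM hu hu'
  exact (h.lineLattice hp k).isLattice hV

theorem lineLattice_le_iff {M : Submodule 𝒪[K] V} (hM : M.IsLattice K) {u : V} (hu : u ∈ M)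
    (hu' : u ∉ (p : K) • M) {j k : ℕ} :
    lineLattice p u k M ≤ lineLattice p u j M ↔ j ≤ k := by
  refine ⟨fun hle => ?_, lineLattice_anti p u M⟩
  obtain ⟨w, h⟩ := exists_isFrame_left hV hp hM hu hu'
  have := hle (h.lineLattice hp k).right_mem
  have := (h.mem_lineLattice_iff p j (a := 0) (b := p ^ k)).1 (by simpa using this)
  exact (pow_dvd_pow_iff hp.ne_zero hp.not_isUnit).1 this

/-- Elementary divisors: a lattice between `pʲ M` and `M` that contains `u ∈ M ∖ pM` is
one of the lattices `𝒪[K] u + pᵏ M`. -/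
theorem eq_lineLattice {M N : Submodule 𝒪[K] V} (hM : M.IsLattice K) {u : V} (hu : u ∈ N)
    (hu' : u ∉ (p : K) • M) (hN : N ≤ M) {j : ℕ} (hj : ((p : K) ^ j) • M ≤ N) :
    ∃ k ≤ j, N = lineLattice p u k M := by
  obtain ⟨w, h⟩ := exists_isFrame_left hV hp hM (hN hu) hu'
  let I : Ideal 𝒪[K] := N.comap (LinearMap.toSpanSingleton 𝒪[K] V w)
  have hI : ∀ b : 𝒪[K], b ∈ I ↔ b • w ∈ N := fun b => Iff.rfl
  have hjI : p ^ j ∈ I := (hI _).2 (hj (Submodule.smul_mem_pointwise_smul w _ M h.right_mem))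
  have hI0 : I ≠ ⊥ := by
    intro h0
    rw [h0, Ideal.mem_bot] at hjI
    exact pow_ne_zero _ hp.ne_zero hjI
  obtain ⟨k, hk⟩ := IsDiscreteValuationRing.ideal_eq_span_pow_irreducible hI0 hp
  have hI' : ∀ b : 𝒪[K], b • w ∈ N ↔ p ^ k ∣ b := fun b => by
    rw [← hI, hk, Ideal.mem_span_singleton]
  refine ⟨k, (pow_dvd_pow_iff hp.ne_zero hp.not_isUnit).1 ((hI' _).1 ((hI _).1 hjI)), ?_⟩
  ext x
  constructor
  · intro hx
    obtain ⟨a, b, rfl⟩ := h.mem_iff.1 (hN hx)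
    rw [h.mem_lineLattice_iff, ← hI']
    exact (Submodule.add_mem_iff_right N (N.smul_mem a hu)).1 hx
  · intro hx
    obtain ⟨a, b, rfl⟩ := h.mem_iff.1 (lineLattice_le p k (hN hu) hx)
    rw [h.mem_lineLattice_iff, ← hI'] at hx
    exact N.add_mem (N.smul_mem a hu) hx

omit hV hp in
theorem smul_lt_lineLattice_one {M : Submodule 𝒪[K] V} {u : V}
    (hu' : u ∉ (p : K) • M) : (p : K) • M < lineLattice p u 1 M :=
  lt_of_le_not_ge (by simpa using pow_smul_le_lineLattice p u 1 M)
    fun h => hu' (h (self_mem_lineLattice p u 1 M))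

theorem lineLattice_one_lt {M : Submodule 𝒪[K] V} (hM : M.IsLattice K) {u : V} (hu : u ∈ M)
    (hu' : u ∉ (p : K) • M) : lineLattice p u 1 M < M := by
  refine lt_of_le_not_ge (lineLattice_le p 1 hu) fun h => ?_
  have h' : lineLattice p u 0 M ≤ lineLattice p u 1 M := (lineLattice_le p 0 hu).trans h
  rw [lineLattice_le_iff hV hp hM hu hu'] at h'
  omega

theorem eq_lineLattice_one {M N : Submodule 𝒪[K] V} (hM : M.IsLattice K)
    (h1 : (p : K) • M ≤ N) (h2 : N < M) {u : V} (hu : u ∈ N) (hu' : u ∉ (p : K) • M) :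
    N = lineLattice p u 1 M := by
  obtain ⟨k, hk, rfl⟩ := eq_lineLattice hV hp hM hu hu' h2.le (j := 1) (by simpa using h1)
  rcases Nat.le_one_iff_eq_zero_or_eq_one.1 hk with rfl | rfl
  · exact absurd (lineLattice_zero p (h2.le hu)) h2.ne
  · rfl

/-- Lattices strictly between `pM` and `M` that are comparable are equal. -/
theorem eq_of_le_of_between {M N N' : Submodule 𝒪[K] V} (hM : M.IsLattice K)
    (h1 : (p : K) • M < N) (hle : N ≤ N') (h2 : N' < M) : N = N' := by
  obtain ⟨u, hu, hu'⟩ := SetLike.exists_of_lt h1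
  rw [eq_lineLattice_one hV hp hM h1.le (hle.trans_lt h2) hu hu',
    eq_lineLattice_one hV hp hM (h1.le.trans hle) h2 (hle hu) hu']

/-- Homothetic lattices strictly between `pM` and `M` are equal. -/
theorem eq_of_isClassOf_of_between {M N N' : Submodule 𝒪[K] V} {v : TreeVertex K V}
    (h : v.IsClassOf N) (h' : v.IsClassOf N')
    (h1 : (p : K) • M < N) (h2 : N < M) (h1' : (p : K) • M < N') (h2' : N' < M) : N = N' := by
  obtain ⟨n, rfl⟩ := h.exists_zpow_smul hp h'
  have hp0 := coe_ne_zero_of_irreducible hp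
  -- a positive power of `p` takes sublattices of `M` into `pM`
  have key : ∀ (n : ℤ) (N : Submodule 𝒪[K] V), 0 < n → N < M → ((p : K) ^ n) • N ≤ (p : K) • M := by
    intro n N hn h2
    obtain ⟨m, rfl⟩ := Int.eq_succ_of_zero_lt hn
    rw [← Nat.cast_succ, zpow_natCast, pow_succ', mul_smul]
    exact smul_mono_right _ ((coe_smul_le (p ^ m) N).trans h2.le)
  rcases lt_trichotomy n 0 with hn | rfl | hn
  · have := key (-n) _ (by omega) h2'
    rw [smul_smul, ← zpow_add₀ hp0, neg_add_cancel, zpow_zero, one_smul] at this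
    exact absurd this h1.not_ge
  · simp
  · exact absurd (key n N hn h2) h1'.not_ge

omit hV in
/-- Every vector is brought into a given lattice by a power of `p`. -/
theorem exists_pow_smul_mem {M : Submodule 𝒪[K] V} (hM : M.IsLattice K) (x : V) :
    ∃ j : ℕ, p ^ j • x ∈ M := by
  have hp0 := coe_ne_zero_of_irreducible hp
  have hx : x ∈ Submodule.span K (M : Set V) := hM.span_eq_top ▸ Submodule.mem_top
  induction hx using Submodule.span_induction with
  | mem x hx => exact ⟨0, by simpa using hx⟩
  | zero => exact ⟨0, by simp⟩
  | add x y _ _ hx hy =>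
    obtain ⟨i, hi⟩ := hx
    obtain ⟨j, hj⟩ := hy
    refine ⟨i + j, ?_⟩
    rw [smul_add]
    refine M.add_mem ?_ ?_
    · rw [pow_add, mul_comm, mul_smul]
      exact M.smul_mem _ hi
    · rw [pow_add, mul_smul]
      exact M.smul_mem _ hj
  | smul a x _ hx =>
    obtain ⟨j, hj⟩ := hx
    rcases eq_or_ne a 0 with rfl | ha
    · exact ⟨0, by simp⟩
    obtain ⟨n, u, rfl⟩ := exists_zpow_mul_unit hp ha
    obtain ⟨m, hm⟩ : ∃ m : ℕ, 0 ≤ m + n := ⟨n.natAbs, by omega⟩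
    obtain ⟨i, hi⟩ := Int.eq_ofNat_of_zero_le hm
    refine ⟨m + j, ?_⟩
    have : p ^ (m + j) • ((p : K) ^ n * ((u : 𝒪[K]) : K)) • x = (u * p ^ i) • p ^ j • x := by
      change ((p : K) ^ (m + j)) • ((p : K) ^ n * ((u : 𝒪[K]) : K)) • x
        = (((u : 𝒪[K]) : K) * (p : K) ^ i) • ((p : K) ^ j) • x
      rw [smul_smul, smul_smul]
      congr 1
      have : (p : K) ^ i = (p : K) ^ m * (p : K) ^ n := by
        rw [← zpow_natCast, ← hi, zpow_add₀ hp0, zpow_natCast]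
      rw [this]
      ring
    rw [this]
    exact M.smul_mem _ hj

/-- Any lattice becomes, after a homothety, one of the lattices `𝒪[K] u + pᵏ M`
with `u ∈ M ∖ pM`. -/
theorem exists_smul_eq_lineLattice {M N : Submodule 𝒪[K] V} (hM : M.IsLattice K)
    (hN : N.IsLattice K) : ∃ c : K, c ≠ 0 ∧ ∃ (k : ℕ) (u : V), u ∈ M ∧ u ∉ (p : K) • M ∧
      c • N = lineLattice p u k M := by
  have hp0 := coe_ne_zero_of_irreducible hp
  have key' : ∀ {M N : Submodule 𝒪[K] V}, M.IsLattice K → N.IsLattice K →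
      ∃ j : ℕ, ((p : K) ^ j) • N ≤ M := by
    intro M N hM hN
    obtain ⟨e, f, h⟩ := exists_isFrame hV hN
    obtain ⟨i, hi⟩ := exists_pow_smul_mem hp hM e
    obtain ⟨j, hj⟩ := exists_pow_smul_mem hp hM f
    refine ⟨i + j, fun x hx => ?_⟩
    obtain ⟨y, hy, rfl⟩ := (mem_pow_smul_iff p _).1 hx
    obtain ⟨a, b, rfl⟩ := h.mem_iff.1 hy
    have : p ^ (i + j) • (a • e + b • f)
        = (a * p ^ j) • p ^ i • e + (b * p ^ i) • p ^ j • f := by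
      rw [pow_add]
      module
    rw [this]
    exact M.add_mem (M.smul_mem _ hi) (M.smul_mem _ hj)
  obtain ⟨j, hj⟩ := key' hM hN
  obtain ⟨e, f, hef⟩ := exists_isFrame hV hM
  obtain ⟨i, hi⟩ := key' (hN.smul (A := K) (a := Units.mk0 _ (pow_ne_zero j hp0))) hM
  have hi : ((p : K) ^ i) • M ≤ ((p : K) ^ j) • N := hi
  -- `l` is the largest exponent with `pʲ N ⊆ pˡ M`
  have hex : ∃ l : ℕ, ¬ ((p : K) ^ j) • N ≤ ((p : K) ^ (l + 1)) • M := by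
    refine ⟨i, fun h => ?_⟩
    have := (h.trans' hi) (Submodule.smul_mem_pointwise_smul e _ M hef.left_mem)
    have := (hef.mem_pow_smul_iff p (i + 1) (a := p ^ i) (b := 0)).1 (by rwa [zero_smul, add_zero])
    have := (pow_dvd_pow_iff hp.ne_zero hp.not_isUnit).1 this.1
    omega
  classical
  obtain ⟨l, hl1, hl2⟩ : ∃ l : ℕ, ((p : K) ^ j) • N ≤ ((p : K) ^ l) • M ∧
      ¬ ((p : K) ^ j) • N ≤ ((p : K) ^ (l + 1)) • M := by
    refine ⟨Nat.find hex, ?_, Nat.find_spec hex⟩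
    rcases h : Nat.find hex with _ | m
    · simpa using hj
    · exact not_not.1 (Nat.find_min hex (h ▸ Nat.lt_succ_self m))
  have hpl : ((p : K) ^ l) ≠ 0 := pow_ne_zero _ hp0
  have hN' : ((p : K) ^ j) • N = ((p : K) ^ l) • (((p : K) ^ l)⁻¹ * (p : K) ^ j) • N := by
    rw [smul_smul, mul_inv_cancel_left₀ hpl]
  refine ⟨((p : K) ^ l)⁻¹ * (p : K) ^ j, mul_ne_zero (inv_ne_zero hpl) (pow_ne_zero _ hp0), ?_⟩
  rw [hN', smul_le_smul_iff_of_ne_zero hpl] at hl1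
  rw [pow_succ, mul_smul, hN', smul_le_smul_iff_of_ne_zero hpl] at hl2
  obtain ⟨u, hu, hu'⟩ := SetLike.not_le_iff_exists.1 hl2
  have hi' : ((p : K) ^ i) • M ≤ (((p : K) ^ l)⁻¹ * (p : K) ^ j) • N := by
    rw [← smul_le_smul_iff_of_ne_zero hpl, ← hN', smul_smul, ← pow_add]
    exact (pow_smul_anti p M (by omega)).trans hi
  obtain ⟨k, -, hk⟩ := eq_lineLattice hV hp hM hu hu' hl1 hi'
  exact ⟨k, u, hl1 hu, hu', hk⟩

end Lattices

/-! ### A criterion for trees -/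

/-- A graph is a tree if it carries a height function that changes by one along each edge, such
that every vertex of positive height has exactly one lower neighbour and only one vertex has
height zero. A cycle is impossible: at a vertex of maximal height it would arrive from, and leave
to, the same lower neighbour. -/
theorem SimpleGraph.isTree_of_height {V : Type*} {G : SimpleGraph V} (h : V → ℕ) (r : V)
    (hr : ∀ v, h v = 0 → v = r)
    (hadj : ∀ {v w}, G.Adj v w → h w = h v + 1 ∨ h v = h w + 1)
    (hex : ∀ v, h v ≠ 0 → ∃ w, G.Adj v w ∧ h v = h w + 1)
    (huniq : ∀ {v w w'}, G.Adj v w → G.Adj v w' → h v = h w + 1 → h v = h w' + 1 → w = w') :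
    G.IsTree := by
  have hreach : ∀ n v, h v = n → G.Reachable v r := by
    intro n
    induction n with
    | zero => rintro v hv; rw [hr v hv]
    | succ n ih =>
      intro v hv
      obtain ⟨w, hw, hvw⟩ := hex v (by omega)
      exact hw.reachable.trans (ih w (by omega))
  have : Nonempty V := ⟨r⟩
  refine ⟨⟨fun v w => (hreach _ v rfl).trans (hreach _ w rfl).symm⟩, ?_⟩
  intro v c hc
  classical
  obtain ⟨m, hm, hmax⟩ := c.support.toFinset.exists_max_image h ⟨v, by simp⟩
  rw [List.mem_toFinset] at hm
  have hc' := hc.rotate hm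
  set d := c.rotate m hm with hd
  have hmax' : ∀ x ∈ d.support, h x ≤ h m := fun x hx =>
    hmax x (List.mem_toFinset.2 ((c.mem_support_rotate_iff m hm).1 hx))
  have h1 := d.adj_snd hc'.not_nil
  have h2 := (d.adj_penultimate hc'.not_nil).symm
  refine hc'.snd_ne_penultimate (huniq h1 h2 ?_ ?_)
  · have hle : h d.snd ≤ h m := hmax' _ (d.getVert_mem_support 1)
    rcases hadj h1 with h' | h'
    · omega
    · exact h'
  · have hle : h d.penultimate ≤ h m := hmax' _ (d.getVert_mem_support (d.length - 1))
    rcases hadj h2 with h' | h'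
    · omega
    · exact h'

/-! ### The Bruhat–Tits tree is a homogeneous tree -/

section Homogeneous

variable {K : Type*} [Field K] [ValuativeRel K] [TopologicalSpace K] [IsNonarchimedeanLocalField K]
variable {V : Type*} [AddCommGroup V] [Module K V]

set_option linter.unusedSectionVars false

/-- `v` is the class of `𝒪[K] u + pᵏ M` for some `u ∈ M ∖ pM`. In the tree this means that `v` has
distance `k` from the class of `M`. -/
def TreeVertex.HasHeight (p : 𝒪[K]) (M : Submodule 𝒪[K] V) (k : ℕ) (v : TreeVertex K V) : Prop :=
  ∃ u ∈ M, u ∉ (p : K) • M ∧ v.IsClassOf (lineLattice p u k M)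

variable (hV : Module.finrank K V = 2) {p : 𝒪[K]} (hp : Irreducible p)
  {M : Submodule 𝒪[K] V} (hM : M.IsLattice K)
include hV hp hM

theorem TreeVertex.exists_hasHeight (v : TreeVertex K V) : ∃ k, v.HasHeight p M k := by
  obtain ⟨N, hN⟩ := v.exists_isClassOf
  obtain ⟨c, hc, k, u, hu, hu', h⟩ := exists_smul_eq_lineLattice hV hp hM hN.isLattice
  exact ⟨k, u, hu, hu', h ▸ hN.smul hc⟩

/-- The height is well defined. -/
theorem TreeVertex.HasHeight.unique {v : TreeVertex K V} {j k : ℕ} (hj : v.HasHeight p M j)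
    (hk : v.HasHeight p M k) : j = k := by
  have hp0 := coe_ne_zero_of_irreducible hp
  obtain ⟨u, hu, hu', h⟩ := hj
  obtain ⟨w, hw, hw', h'⟩ := hk
  obtain ⟨n, hn⟩ := h.exists_zpow_smul hp h'
  -- a positive power of `p` takes sublattices of `M` into `pM`
  have key : ∀ (n : ℤ) (x y : V) (i j : ℕ), x ∈ M → y ∉ (p : K) • M →
      lineLattice p y j M = ((p : K) ^ n) • lineLattice p x i M → ¬ 0 < n := by
    intro n x y i j hx hy e hn
    obtain ⟨m, rfl⟩ := Int.eq_succ_of_zero_lt hn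
    rw [← Nat.cast_succ, zpow_natCast, pow_succ', mul_smul] at e
    have hle : lineLattice p y j M ≤ (p : K) • M := by
      rw [e]
      exact smul_mono_right _ ((coe_smul_le (p ^ m) _).trans (lineLattice_le p i hx))
    exact hy (hle (self_mem_lineLattice p y j M))
  have h1 := key n u w j k hu hw' hn
  have h2 := key (-n) w u k j hw hu'
    (by rw [hn, smul_smul, ← zpow_add₀ hp0, neg_add_cancel, zpow_zero, one_smul])
  obtain rfl : n = 0 := by omega
  rw [zpow_zero, one_smul] at hn
  -- the exponent `k` is determined by the lattice
  have key' : ∀ (x y : V) (i j : ℕ), x ∈ M → y ∈ M → y ∉ (p : K) • M →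
      lineLattice p y j M = lineLattice p x i M → j ≤ i := by
    intro x y i j hx hy hy' e
    obtain ⟨k, hk, h⟩ := eq_lineLattice hV hp hM (e ▸ self_mem_lineLattice p y j M) hy'
      (lineLattice_le p i hx) (pow_smul_le_lineLattice p x i M)
    rw [h] at e
    exact ((lineLattice_le_iff hV hp hM hy hy').1 e.ge).trans hk
  exact le_antisymm (key' w u k j hw hu hu' hn.symm) (key' u w j k hu hw hw' hn)

/-- The lattices below `𝒪[K] u + pᵏ M` that represent its neighbours: all of them have height
`k + 1`, except for `p (𝒪[K] u + pᵏ⁻¹ M)` when `0 < k`. -/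
theorem hasHeight_succ_or_eq {u : V} (hu : u ∈ M) (hu' : u ∉ (p : K) • M) {k : ℕ}
    {N : Submodule 𝒪[K] V} (h1 : (p : K) • lineLattice p u k M < N)
    (h2 : N < lineLattice p u k M) :
    (∃ x ∈ M, x ∉ (p : K) • M ∧ N = lineLattice p x (k + 1) M) ∨
      ∃ j, k = j + 1 ∧ N = (p : K) • lineLattice p u j M := by
  have hNM := h2.le.trans (lineLattice_le p k hu)
  by_cases hN : N ≤ (p : K) • M
  · right
    obtain ⟨w, h⟩ := exists_isFrame_left hV hp hM hu hu'
    rcases k with _ | j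
    · rw [lineLattice_zero p hu] at h1
      exact absurd hN h1.not_ge
    refine ⟨j, rfl, le_antisymm ?_ ?_⟩
    · intro x hx
      obtain ⟨a, b, rfl⟩ := h.mem_iff.1 (hNM hx)
      obtain ⟨⟨a, rfl⟩, -⟩ := (h.mem_smul_iff p).1 (hN hx)
      obtain ⟨b, rfl⟩ := (h.mem_lineLattice_iff p (j + 1)).1 (h2.le hx)
      refine (mem_coe_smul_iff p).2 ⟨a • u + (p ^ j * b) • w,
        (h.mem_lineLattice_iff p j).2 (dvd_mul_right _ _), ?_⟩
      rw [pow_succ]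
      module
    · obtain ⟨x, hx, hx'⟩ := SetLike.exists_of_lt h1
      obtain ⟨a, b, rfl⟩ := h.mem_iff.1 (hNM hx)
      obtain ⟨⟨a, rfl⟩, -⟩ := (h.mem_smul_iff p).1 (hN hx)
      obtain ⟨b, rfl⟩ := (h.mem_lineLattice_iff p (j + 1)).1 (h2.le hx)
      have hpu : p • u ∈ N :=
        h1.le ((mem_coe_smul_iff p).2 ⟨u, self_mem_lineLattice p u _ M, rfl⟩)
      have hb : IsUnit b := by
        refine isUnit_of_not_dvd hp ?_
        rintro ⟨b, rfl⟩
        refine hx' ((mem_coe_smul_iff p).2 ⟨a • u + (p ^ (j + 1) * b) • w,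
          (h.mem_lineLattice_iff p _).2 (dvd_mul_right _ _), ?_⟩)
        module
      obtain ⟨b, rfl⟩ := hb
      have hw : p ^ (j + 1) • w ∈ N := by
        have : (p ^ (j + 1) * ↑b) • w ∈ N := by
          refine (Submodule.add_mem_iff_right N ?_).1 hx
          rw [mul_comm, mul_smul]
          exact N.smul_mem _ hpu
        have := N.smul_mem (↑b⁻¹ : 𝒪[K]) this
        rwa [smul_smul, mul_comm, mul_assoc, Units.mul_inv, mul_one] at this
      intro y hy
      obtain ⟨z, hz, rfl⟩ := (mem_coe_smul_iff p).1 hy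
      obtain ⟨c, d, rfl⟩ := h.mem_iff.1 (lineLattice_le p j hu hz)
      obtain ⟨d, rfl⟩ := (h.mem_lineLattice_iff p j).1 hz
      have : p • (c • u + (p ^ j * d) • w) = c • p • u + d • p ^ (j + 1) • w := by
        rw [pow_succ]
        module
      rw [this]
      exact N.add_mem (N.smul_mem _ hpu) (N.smul_mem _ hw)
  · left
    obtain ⟨x, hx, hx'⟩ := SetLike.not_le_iff_exists.1 hN
    have hxM := hNM hx
    have hkN : ((p : K) ^ (k + 1)) • M ≤ N := by
      rw [pow_succ', mul_smul]
      exact (smul_mono_right _ (pow_smul_le_lineLattice p u k M)).trans h1.le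
    obtain ⟨j, hj, rfl⟩ := eq_lineLattice hV hp hM hx hx' hNM hkN
    refine ⟨x, hxM, hx', ?_⟩
    obtain ⟨i, hi, h⟩ := eq_lineLattice hV hp hM (h2.le hx) hx'
      (lineLattice_le p k hu) (pow_smul_le_lineLattice p u k M)
    have hlt : ¬ j ≤ i := fun hle => h2.not_ge (h ▸ lineLattice_anti p x M hle)
    have hik : k ≤ i := by
      have hw := isLattice_lineLattice hV hp hM hu hu' k
      exact (TreeVertex.HasHeight.unique hV hp hM (v := Quotient.mk _ ⟨_, hw⟩)
        ⟨u, hu, hu', hw, rfl⟩ ⟨x, hxM, hx', h ▸ ⟨hw, rfl⟩⟩).le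
    rw [show j = k + 1 by omega]

theorem adj_lineLattice {u : V} (hu : u ∈ M) (hu' : u ∉ (p : K) • M) {k : ℕ}
    {v w : TreeVertex K V} (hv : v.IsClassOf (lineLattice p u (k + 1) M))
    (hw : w.IsClassOf (lineLattice p u k M)) : (bruhatTitsTree K V).Adj v w := by
  refine ((adj_iff_exists_lattice hp hw).2 ⟨_, hv, ?_, ?_⟩).symm
  · refine lt_of_le_not_ge ?_ fun h => ?_
    · rintro x hx
      obtain ⟨w, h⟩ := exists_isFrame_left hV hp hM hu hu'
      obtain ⟨y, hy, rfl⟩ := (mem_coe_smul_iff p).1 hx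
      obtain ⟨a, b, rfl⟩ := h.mem_iff.1 (lineLattice_le p k hu hy)
      obtain ⟨b, rfl⟩ := (h.mem_lineLattice_iff p k).1 hy
      rw [smul_add, smul_smul, smul_smul, h.mem_lineLattice_iff p]
      exact ⟨b, by ring⟩
    · exact hu' (smul_mono_right (p : K) (lineLattice_le p k hu)
        (h (self_mem_lineLattice p u (k + 1) M)))
  · refine lt_of_le_not_ge (lineLattice_anti p u M k.le_succ) fun h => ?_
    rw [lineLattice_le_iff hV hp hM hu hu'] at h
    omega

omit hM in
theorem bruhatTitsTree_isTree : (bruhatTitsTree K V).IsTree := by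
  obtain ⟨M, hM⟩ : ∃ M : Submodule 𝒪[K] V, M.IsLattice K := by
    have : FiniteDimensional K V := Module.finite_of_finrank_eq_succ hV
    let b := Module.finBasisOfFinrankEq K V hV
    refine ⟨Submodule.span 𝒪[K] (Set.range b), Submodule.fg_span (Set.finite_range b), ?_⟩
    rw [Submodule.span_span_of_tower, b.span_eq]
  choose h hh using fun v : TreeVertex K V => v.exists_hasHeight hV hp hM
  have heq : ∀ {v : TreeVertex K V} {k}, v.HasHeight p M k → h v = k := fun hk =>
    (hh _).unique hV hp hM hk
  have hnbr : ∀ {v w}, (bruhatTitsTree K V).Adj v w → ∀ {u}, u ∈ M → u ∉ (p : K) • M →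
      v.IsClassOf (lineLattice p u (h v) M) → h w = h v + 1 ∨
        ∃ j, h v = j + 1 ∧ h w = j ∧ w.IsClassOf (lineLattice p u j M) := by
    intro v w hvw u hu hu' hv
    obtain ⟨N, hw, h1, h2⟩ := (adj_iff_exists_lattice hp hv).1 hvw
    rcases hasHeight_succ_or_eq hV hp hM hu hu' h1 h2 with ⟨x, hx, hx', rfl⟩ | ⟨j, hj, rfl⟩
    · exact Or.inl (heq ⟨x, hx, hx', hw⟩)
    · have hw' := hw.of_smul (coe_ne_zero_of_irreducible hp)
      exact Or.inr ⟨j, hj, heq ⟨u, hu, hu', hw'⟩, hw'⟩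
  refine SimpleGraph.isTree_of_height h (Quotient.mk _ ⟨M, hM⟩) ?_ ?_ ?_ ?_
  · intro v hv
    obtain ⟨u, hu, -, hv'⟩ := hh v
    rw [hv, lineLattice_zero p hu] at hv'
    exact hv'.eq ⟨hM, rfl⟩
  · intro v w hvw
    obtain ⟨u, hu, hu', hv⟩ := hh v
    rcases hnbr hvw hu hu' hv with h | ⟨j, hj, hj', -⟩ <;> omega
  · intro v hv
    obtain ⟨u, hu, hu', hv'⟩ := hh v
    obtain ⟨j, hj⟩ := Nat.exists_eq_succ_of_ne_zero hv
    rw [hj] at hv'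
    have hL := isLattice_lineLattice hV hp hM hu hu' j
    refine ⟨Quotient.mk _ ⟨_, hL⟩, adj_lineLattice hV hp hM hu hu' hv' ⟨hL, rfl⟩, ?_⟩
    rw [heq ⟨u, hu, hu', hL, rfl⟩, hj]
  · intro v w w' hw hw' h1 h1'
    obtain ⟨u, hu, hu', hv⟩ := hh v
    rcases hnbr hw hu hu' hv with h2 | ⟨j, hj, -, h2⟩
    · omega
    rcases hnbr hw' hu hu' hv with h2' | ⟨j', hj', -, h2'⟩
    · omega
    obtain rfl : j = j' := by omega
    exact h2.eq h2'

omit hM in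
/-- The neighbours of the class of `M` correspond to the `q + 1` lines of `M / pM`. -/
theorem encard_neighborSet (v : TreeVertex K V) :
    ((bruhatTitsTree K V).neighborSet v).encard = (Nat.card 𝓀[K] : ℕ∞) + 1 := by
  obtain ⟨M, hv⟩ := v.exists_isClassOf
  have hM := hv.isLattice
  obtain ⟨u, w, h⟩ := exists_isFrame hV hM
  have hout : ∀ a : 𝓀[K], IsLocalRing.residue 𝒪[K] a.out = a := fun a => Quotient.out_eq a
  have hdvd : ∀ a b : 𝒪[K],
      p ∣ a - b ↔ IsLocalRing.residue 𝒪[K] a = IsLocalRing.residue 𝒪[K] b := by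
    intro a b
    rw [← sub_eq_zero, ← map_sub, IsLocalRing.residue_eq_zero_iff, hp.maximalIdeal_eq,
      Ideal.mem_span_singleton]
  -- the representatives `w` and `u + a w`, for `a` in the residue field, of the lines of `M / pM`
  let g : Option 𝓀[K] → V := fun a => a.elim w fun a => u + (a.out : 𝒪[K]) • w
  have hgM : ∀ a, g a ∈ M := by
    rintro (_ | a)
    exacts [h.right_mem, M.add_mem h.left_mem (M.smul_mem _ h.right_mem)]
  have hgM' : ∀ a, g a ∉ (p : K) • M := by
    rintro (_ | a) ha
    · exact h.symm.left_notMem hp ha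
    · have := (h.mem_smul_iff p (a := 1) (b := a.out)).1 (by rwa [one_smul])
      exact hp.not_isUnit (isUnit_of_dvd_one this.1)
  have hlat := fun a => isLattice_lineLattice hV hp hM (hgM a) (hgM' a) 1
  let f : Option 𝓀[K] → TreeVertex K V := fun a => Quotient.mk _ ⟨_, hlat a⟩
  have hf : ∀ a, (f a).IsClassOf (lineLattice p (g a) 1 M) := fun a => ⟨_, rfl⟩
  -- the vectors `g a` span different lines modulo `p`
  have hg : ∀ a b, g a ∈ lineLattice p (g b) 1 M → a = b := by
    intro a b hab
    have hframe : ∀ b : 𝓀[K], IsFrame (u + (b.out : 𝒪[K]) • w) w M := by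
      intro b
      refine isFrame_of_span_eq hV hM (le_antisymm ?_ ?_)
      · intro x hx
        obtain ⟨c, d, rfl⟩ := h.mem_iff.1 hx
        exact Submodule.mem_span_pair.2 ⟨c, d - c * b.out, by module⟩
      · rw [Submodule.span_le]
        rintro x (rfl | rfl)
        exacts [hgM (some b), h.right_mem]
    rcases b with _ | b
    · rcases a with _ | a
      · rfl
      · have := (h.symm.mem_lineLattice_iff p 1 (a := a.out) (b := 1)).1
          (by rw [one_smul, add_comm]; exact hab)
        rw [pow_one] at this
        exact absurd (isUnit_of_dvd_one this) hp.not_isUnit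
    · rcases a with _ | a
      · have := ((hframe b).mem_lineLattice_iff p 1 (a := 0) (b := 1)).1
          (by rw [one_smul, zero_smul, zero_add]; exact hab)
        rw [pow_one] at this
        exact absurd (isUnit_of_dvd_one this) hp.not_isUnit
      · have e : (1 : 𝒪[K]) • (u + (b.out : 𝒪[K]) • w) + ((a.out : 𝒪[K]) - b.out) • w
            = g (some a) := by
          change _ = u + (a.out : 𝒪[K]) • w
          module
        have := ((hframe b).mem_lineLattice_iff p 1 (a := 1) (b := a.out - b.out)).1
          (by rw [e]; exact hab)
        rw [pow_one, hdvd, hout, hout] at this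
        rw [this]
  have hinj : Function.Injective f := by
    intro a b hab
    refine hg a b ?_
    have hlt := fun a => smul_lt_lineLattice_one (hgM' a)
    have hlt' := fun a => lineLattice_one_lt hV hp hM (hgM a) (hgM' a)
    rw [← eq_of_isClassOf_of_between hV hp (hf a) (hab ▸ hf b) (hlt a) (hlt' a) (hlt b) (hlt' b)]
    exact self_mem_lineLattice _ _ _ _
  have hrange : (bruhatTitsTree K V).neighborSet v = Set.range f := by
    ext v'
    rw [SimpleGraph.mem_neighborSet, adj_iff_exists_lattice hp hv]
    constructor
    · rintro ⟨N, hN, h1, h2⟩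
      suffices ∃ a, g a ∈ N by
        obtain ⟨a, ha⟩ := this
        refine ⟨a, ?_⟩
        rw [eq_lineLattice_one hV hp hM h1.le h2 ha (hgM' a)] at hN
        exact (hf a).eq hN
      obtain ⟨x, hx, hx'⟩ := SetLike.exists_of_lt h1
      obtain ⟨a, b, rfl⟩ := h.mem_iff.1 (h2.le hx)
      have hpN : ∀ y ∈ M, p • y ∈ N := fun y hy => h1.le ((mem_coe_smul_iff p).2 ⟨y, hy, rfl⟩)
      by_cases ha : p ∣ a
      · obtain ⟨b, rfl⟩ := isUnit_of_not_dvd hp fun hb => hx' ((h.mem_smul_iff p).2 ⟨ha, hb⟩)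
        obtain ⟨a, rfl⟩ := ha
        refine ⟨none, ?_⟩
        have e : w = (↑b⁻¹ : 𝒪[K]) • ((p * a) • u + (b : 𝒪[K]) • w)
            - p • (↑b⁻¹ * a : 𝒪[K]) • u := by
          rw [smul_add, smul_smul _ (b : 𝒪[K]), Units.inv_mul]
          module
        change w ∈ N
        rw [e]
        exact N.sub_mem (N.smul_mem _ hx) (hpN _ (M.smul_mem _ h.left_mem))
      · obtain ⟨a, rfl⟩ := isUnit_of_not_dvd hp ha
        refine ⟨some (IsLocalRing.residue 𝒪[K] (↑a⁻¹ * b)), ?_⟩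
        change u + ((IsLocalRing.residue 𝒪[K] (↑a⁻¹ * b)).out : 𝒪[K]) • w ∈ N
        obtain ⟨c, hc⟩ := (hdvd ((IsLocalRing.residue 𝒪[K] (↑a⁻¹ * b)).out) (↑a⁻¹ * b)).2 (hout _)
        rw [sub_eq_iff_eq_add] at hc
        have e : u + (p * c + ↑a⁻¹ * b) • w
            = (↑a⁻¹ : 𝒪[K]) • ((a : 𝒪[K]) • u + b • w) + p • c • w := by
          rw [smul_add, smul_smul _ (a : 𝒪[K]), Units.inv_mul]
          module
        rw [hc, e]
        exact N.add_mem (N.smul_mem _ hx) (hpN _ (M.smul_mem _ h.right_mem))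
    · rintro ⟨a, rfl⟩
      exact ⟨_, hf a, smul_lt_lineLattice_one (hgM' a),
        lineLattice_one_lt hV hp hM (hgM a) (hgM' a)⟩
  rw [hrange, ← Set.image_univ, hinj.encard_image, Set.encard_univ, ENat.card_eq_coe_natCard,
    Finite.card_option]
  rfl

omit hM in
theorem bruhatTitsTree_isHomogeneousTree :
    IsHomogeneousTree (bruhatTitsTree K V) (Nat.card 𝓀[K]) :=
  ⟨bruhatTitsTree_isTree hV hp, encard_neighborSet hV hp⟩

end Homogeneous

/-! ### Cyclic vectors -/

section Cyclic

variable {K : Type*} [Field K] [ValuativeRel K] [TopologicalSpace K] [IsNonarchimedeanLocalField K]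
variable {V : Type*} [AddCommGroup V] [Module K V]

/-- An endomorphism `φ` of a lattice `M` in a plane that is not a scalar modulo `p` has a cyclic
vector: otherwise every vector of `M / pM` would be an eigenvector of `φ`. -/
theorem exists_isFrame_apply (hV : Module.finrank K V = 2) {p : 𝒪[K]} (hp : Irreducible p)
    {M : Submodule 𝒪[K] V} (hM : M.IsLattice K) (φ : V →ₗ[𝒪[K]] V) (hφ : ∀ x ∈ M, φ x ∈ M)
    (h : ∀ c : 𝒪[K], ∃ x ∈ M, φ x - c • x ∉ (p : K) • M) : ∃ x, IsFrame x (φ x) M := by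
  by_contra! hno
  have key : ∀ x ∈ M, x ∉ (p : K) • M → ∃ a : 𝒪[K], φ x - a • x ∈ (p : K) • M := by
    intro x hx hx'
    obtain ⟨w, hw⟩ := exists_isFrame_left hV hp hM hx hx'
    obtain ⟨a, b, hab⟩ := hw.mem_iff.1 (hφ x hx)
    refine ⟨a, ?_⟩
    have e : φ x - a • x = (0 : 𝒪[K]) • x + b • w := by rw [← hab]; module
    rw [e, hw.mem_smul_iff]
    refine ⟨dvd_zero p, by_contra fun hb => ?_⟩
    obtain ⟨b, rfl⟩ := isUnit_of_not_dvd hp hb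
    exact hno x (hab ▸ hw.smul_add_unit_smul hV a b)
  obtain ⟨e, f, hef⟩ := exists_isFrame hV hM
  obtain ⟨a, ha⟩ := key e hef.left_mem (hef.left_notMem hp)
  obtain ⟨b, hb⟩ := key f hef.right_mem (hef.symm.left_notMem hp)
  obtain ⟨c, hc⟩ := key (e + f) (M.add_mem hef.left_mem hef.right_mem) fun h' => by
    have := (hef.mem_smul_iff p (a := 1) (b := 1)).1 (by simpa only [one_smul] using h')
    exact hp.not_isUnit (isUnit_of_dvd_one this.1)
  -- the eigenvalues at `e`, `f` and `e + f` agree modulo `p`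
  have hca : p ∣ c - a ∧ p ∣ c - b := by
    rw [← hef.mem_smul_iff p]
    convert Submodule.sub_mem _ (Submodule.add_mem _ ha hb) hc using 1
    rw [map_add]
    module
  have hab : p ∣ a - b := by
    have := dvd_sub hca.2 hca.1
    rwa [sub_sub_sub_cancel_left] at this
  obtain ⟨x, hx, hx'⟩ := h a
  obtain ⟨r, s, rfl⟩ := hef.mem_iff.1 hx
  obtain ⟨t, ht⟩ := hab
  refine hx' ?_
  have : φ (r • e + s • f) - a • (r • e + s • f)
      = r • (φ e - a • e) + s • (φ f - b • f) - p • (s * t) • f := by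
    rw [map_add, map_smul, map_smul, smul_smul p, show p * (s * t) = s * (p * t) by ring, ← ht]
    module
  rw [this]
  refine Submodule.sub_mem _ (Submodule.add_mem _ (Submodule.smul_mem _ _ ha)
    (Submodule.smul_mem _ _ hb)) ((mem_coe_smul_iff p).2 ⟨_, M.smul_mem _ hef.right_mem, rfl⟩)

end Cyclic

/-! ### Quadratic orders and their principal ideals -/

section QuadraticOrders

set_option linter.unusedSectionVars false

variable {K : Type*} [Field K] [ValuativeRel K] [TopologicalSpace K] [IsNonarchimedeanLocalField K]
variable {L : Type*} [CommRing L] [Algebra K L]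

theorem mem_toSubmodule_integers {x : L} :
    x ∈ Subalgebra.toSubmodule (integers K L) ↔ IsIntegral 𝒪[K] x := Iff.rfl

/-- If `α² ∈ 𝒪[K] + 𝒪[K] α`, then `𝒪[K][α] = 𝒪[K] + 𝒪[K] α`. -/
theorem toSubmodule_adjoin_singleton {α : L} {r s : 𝒪[K]} (h : α * α = r • (1 : L) + s • α) :
    Subalgebra.toSubmodule (Algebra.adjoin 𝒪[K] {α}) = Submodule.span 𝒪[K] {1, α} := by
  refine le_antisymm ?_ ?_
  · intro x hx
    rw [Subalgebra.mem_toSubmodule] at hx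
    induction hx using Algebra.adjoin_induction with
    | mem x hx =>
      rw [Set.mem_singleton_iff.1 hx]
      exact Submodule.subset_span (by simp)
    | algebraMap a =>
      rw [Algebra.algebraMap_eq_smul_one]
      exact Submodule.smul_mem _ _ (Submodule.subset_span (by simp))
    | add x y _ _ hx hy => exact Submodule.add_mem _ hx hy
    | mul x y _ _ hx hy =>
      obtain ⟨a, b, rfl⟩ := Submodule.mem_span_pair.1 hx
      obtain ⟨c, d, rfl⟩ := Submodule.mem_span_pair.1 hy
      refine Submodule.mem_span_pair.2 ⟨a * c + b * d * r, a * d + b * c + b * d * s, ?_⟩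
      simp only [Algebra.smul_def, map_add, map_mul] at h ⊢
      linear_combination -(algebraMap 𝒪[K] L b * algebraMap 𝒪[K] L d) * h
  · rw [Submodule.span_le]
    rintro x (rfl | rfl)
    exacts [Subalgebra.one_mem _, Algebra.self_mem_adjoin_singleton _ _]

/-- The principal ideal `y O` of an order `O = 𝒪[K] + 𝒪[K] α`, as a submodule of `L`. -/
theorem idealToSubmodule_span_singleton {O : Subalgebra 𝒪[K] L} {α : L}
    (hO : Subalgebra.toSubmodule O = Submodule.span 𝒪[K] {1, α}) (y : O) :
    idealToSubmodule (Ideal.span {y}) = Submodule.span 𝒪[K] {(y : L), α * y} := by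
  have hmem : ∀ z : L, z ∈ O ↔ ∃ a b : 𝒪[K], a • (1 : L) + b • α = z := by
    intro z
    rw [← Subalgebra.mem_toSubmodule, hO, Submodule.mem_span_pair]
  ext z
  constructor
  · rintro ⟨w, hw, rfl⟩
    obtain ⟨c, rfl⟩ := Ideal.mem_span_singleton'.1 (show w ∈ Ideal.span {y} from hw)
    obtain ⟨a, b, hab⟩ := (hmem c).1 c.2
    refine Submodule.mem_span_pair.2 ⟨a, b, ?_⟩
    change _ = (c : L) * y
    rw [← hab, add_mul, smul_mul_assoc, one_mul, smul_mul_assoc]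
  · intro hz
    obtain ⟨a, b, rfl⟩ := Submodule.mem_span_pair.1 hz
    refine ⟨⟨a • (1 : L) + b • α, (hmem _).2 ⟨a, b, rfl⟩⟩ * y, ?_, ?_⟩
    · exact Ideal.mul_mem_left _ _ (Ideal.mem_span_singleton_self y)
    · change (a • (1 : L) + b • α) * y = _
      rw [add_mul, smul_mul_assoc, one_mul, smul_mul_assoc]

theorem isFrame_mul {M : Submodule 𝒪[K] L} {u w x : L} (h : IsFrame u w M) (hx : IsUnit x) :
    IsFrame (x * u) (x * w) (Submodule.span 𝒪[K] {x * u, x * w}) := by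
  refine ⟨?_, rfl⟩
  have := h.linearIndependent
  rw [LinearIndependent.pair_iff] at this ⊢
  intro s t e
  refine this s t (hx.mul_left_cancel ?_)
  rw [mul_zero, mul_add, mul_smul_comm, mul_smul_comm, e]

variable (hL : Module.finrank K L = 2)
include hL

theorem nontrivial_of_finrank_eq_two : Nontrivial L := by
  refine Module.nontrivial_of_finrank_pos (R := K) ?_
  omega

/-- A lattice stable under multiplication by `β` forces `β` to be integral (Cayley–Hamilton). -/
theorem isIntegral_of_mul_mem {M : Submodule 𝒪[K] L} (hM : M.IsLattice K) {β : L}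
    (hβ : ∀ x ∈ M, β * x ∈ M) : IsIntegral 𝒪[K] β := by
  obtain ⟨e, f, h⟩ := exists_isFrame hL hM
  obtain ⟨a, b, h1⟩ := h.mem_iff.1 (hβ e h.left_mem)
  obtain ⟨c, d, h2⟩ := h.mem_iff.1 (hβ f h.right_mem)
  open Polynomial in
  refine ⟨X ^ 2 + (C (-(a + d)) * X + C (a * d - b * c)),
    (monic_X_pow 2).add_of_left ?_, ?_⟩
  · rw [degree_X_pow]
    exact degree_linear_lt_degree_C_mul_X_sq (a := 1) one_ne_zero |>.trans_le (by simp)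
  simp only [eval₂_add, eval₂_mul, eval₂_pow, eval₂_X, eval₂_C, eval₂_neg,
    eval₂_sub, map_sub, map_neg, map_add, map_mul]
  -- the characteristic polynomial of `β` on the lattice kills the frame, hence all of `L`
  set z := β ^ 2 + (-(algebraMap 𝒪[K] L a + algebraMap 𝒪[K] L d) * β +
    (algebraMap 𝒪[K] L a * algebraMap 𝒪[K] L d - algebraMap 𝒪[K] L b * algebraMap 𝒪[K] L c))
    with hz
  rw [Algebra.smul_def, Algebra.smul_def] at h1 h2
  have he : z * e = 0 := by
    rw [hz]
    linear_combination -(β - algebraMap 𝒪[K] L d) * h1 - algebraMap 𝒪[K] L b * h2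
  have hf : z * f = 0 := by
    rw [hz]
    linear_combination -(β - algebraMap 𝒪[K] L a) * h2 - algebraMap 𝒪[K] L c * h1
  have : (1 : L) ∈ Submodule.span K {e, f} := h.span_eq_top hL ▸ Submodule.mem_top
  obtain ⟨r, s, hrs⟩ := Submodule.mem_span_pair.1 this
  rw [← mul_one z, ← hrs, mul_add, mul_smul_comm, mul_smul_comm, he, hf, smul_zero, smul_zero,
    add_zero]

theorem isUnit_of_isFrame_mul {M : Submodule 𝒪[K] L} {x α : L} (h : IsFrame x (α * x) M) :
    IsUnit x := by
  have : (1 : L) ∈ Submodule.span K {x, α * x} := h.span_eq_top hL ▸ Submodule.mem_top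
  obtain ⟨r, s, hrs⟩ := Submodule.mem_span_pair.1 this
  refine IsUnit.of_mul_eq_one (algebraMap K L r + algebraMap K L s * α) ?_
  rw [← hrs]
  simp only [Algebra.smul_def]
  ring

theorem isIntegral_algebraMap_iff_mem {c : K} :
    IsIntegral 𝒪[K] (algebraMap K L c) ↔ ∃ a : 𝒪[K], (a : K) = c := by
  have := nontrivial_of_finrank_eq_two hL
  rw [isIntegral_algebraMap_iff (algebraMap K L).injective, IsIntegrallyClosed.isIntegral_iff]
  rfl

theorem one_notMem_smul_integers {p : 𝒪[K]} (hp : Irreducible p) :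
    (1 : L) ∉ (p : K) • Subalgebra.toSubmodule (integers K L) := by
  have hp0 := coe_ne_zero_of_irreducible hp
  rw [mem_smul_iff hp0, mem_toSubmodule_integers, ← Algebra.algebraMap_eq_smul_one,
    isIntegral_algebraMap_iff_mem hL]
  rintro ⟨a, ha⟩
  refine hp.not_isUnit (IsUnit.of_mul_eq_one a (Subtype.ext ?_))
  change (p : K) * a = 1
  rw [ha, mul_inv_cancel₀ hp0]

/-- If `𝒪[K][Δ]` is the ring of integers, then `(1, Δ)` is an integral basis. If not, `Δ` would lie
in the proper subring `𝒪[K] + p 𝒪_L`. -/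
theorem isFrame_one_of_adjoin_eq
    (hO : (Subalgebra.toSubmodule (integers K L)).IsLattice K) {Δ : L}
    (hΔ : Algebra.adjoin 𝒪[K] {Δ} = integers K L) :
    IsFrame 1 Δ (Subalgebra.toSubmodule (integers K L)) := by
  obtain ⟨p, hp⟩ := IsDiscreteValuationRing.exists_irreducible 𝒪[K]
  obtain ⟨w, h⟩ := exists_isFrame_left hL hp hO (Subalgebra.one_mem _)
    (one_notMem_smul_integers hL hp)
  have hΔO : Δ ∈ Subalgebra.toSubmodule (integers K L) := by
    rw [← hΔ]
    exact Algebra.self_mem_adjoin_singleton _ _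
  obtain ⟨a, b, hab⟩ := h.mem_iff.1 hΔO
  have hb : IsUnit b := by
    refine isUnit_of_not_dvd hp fun hb => ?_
    have key : ∀ x ∈ Algebra.adjoin 𝒪[K] {Δ},
        x ∈ lineLattice p 1 1 (Subalgebra.toSubmodule (integers K L)) := by
      intro x hx
      induction hx using Algebra.adjoin_induction with
      | mem x hx =>
        rw [Set.mem_singleton_iff.1 hx, ← hab, h.mem_lineLattice_iff, pow_one]
        exact hb
      | algebraMap a =>
        rw [Algebra.algebraMap_eq_smul_one]
        exact Submodule.smul_mem _ _ (self_mem_lineLattice _ _ _ _)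
      | add x y _ _ hx hy => exact Submodule.add_mem _ hx hy
      | mul x y hx' hy' hx hy =>
        rw [hΔ] at hx' hy'
        obtain ⟨y1, hy1, y2, hy2, rfl⟩ := Submodule.mem_sup.1 hy
        obtain ⟨c, rfl⟩ := Submodule.mem_span_singleton.1 hy1
        rw [mul_add, mul_smul_comm, mul_one]
        refine Submodule.add_mem _ (Submodule.smul_mem _ _ hx) ?_
        refine pow_smul_le_lineLattice p 1 1 _ ?_
        rw [pow_one] at hy2 ⊢
        obtain ⟨z, hz, rfl⟩ := (mem_coe_smul_iff p).1 hy2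
        rw [mul_smul_comm]
        exact (mem_coe_smul_iff p).2 ⟨_, Subalgebra.mul_mem _ hx' hz, rfl⟩
    have hw := key w (hΔ ▸ h.right_mem)
    have := (h.mem_lineLattice_iff p 1 (a := 0) (b := 1)).1 (by simpa using hw)
    rw [pow_one] at this
    exact hp.not_isUnit (isUnit_of_dvd_one this)
  obtain ⟨b, rfl⟩ := hb
  exact hab ▸ h.smul_add_unit_smul hL a b

/-- The ring of integers is monogenic: `1` extends to an integral basis `(1, Δ)`. -/
theorem exists_adjoin_eq_integers (hO : (Subalgebra.toSubmodule (integers K L)).IsLattice K) :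
    ∃ Δ : L, Algebra.adjoin 𝒪[K] {Δ} = integers K L := by
  obtain ⟨p, hp⟩ := IsDiscreteValuationRing.exists_irreducible 𝒪[K]
  obtain ⟨w, h⟩ := exists_isFrame_left hL hp hO (Subalgebra.one_mem _)
    (one_notMem_smul_integers hL hp)
  obtain ⟨r, s, hrs⟩ := h.mem_iff.1 (Subalgebra.mul_mem (integers K L) h.right_mem h.right_mem)
  refine ⟨w, Subalgebra.toSubmodule_injective ?_⟩
  rw [toSubmodule_adjoin_singleton hrs.symm, ← h.eq_span]

section Order

variable (hO : (Subalgebra.toSubmodule (integers K L)).IsLattice K) {Δ : L}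
  (hΔ : Algebra.adjoin 𝒪[K] {Δ} = integers K L) {p : 𝒪[K]} (hp : Irreducible p)
include hO hΔ hp

theorem isFrame_one_pow_smul (n : ℕ) :
    IsFrame 1 (p ^ n • Δ) (Submodule.span 𝒪[K] {1, p ^ n • Δ}) := by
  have h := (isFrame_one_of_adjoin_eq hL hO hΔ).lineLattice hp n
  exact ⟨h.linearIndependent, rfl⟩

omit hp in
theorem toSubmodule_mainOrder (n : ℕ) :
    Subalgebra.toSubmodule (mainOrder p Δ n) = Submodule.span 𝒪[K] {1, p ^ n • Δ} := by
  have h := isFrame_one_of_adjoin_eq hL hO hΔ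
  obtain ⟨r, s, hrs⟩ := h.mem_iff.1 (Subalgebra.mul_mem (integers K L) h.right_mem h.right_mem)
  refine toSubmodule_adjoin_singleton (r := p ^ n * p ^ n * r) (s := p ^ n * s) ?_
  rw [smul_mul_smul_comm, ← hrs]
  module

end Order

end QuadraticOrders

/-! ### Levels of vertices -/

section Levels

set_option linter.unusedSectionVars false

variable {K : Type*} [Field K] [ValuativeRel K] [TopologicalSpace K] [IsNonarchimedeanLocalField K]
variable {L : Type*} [CommRing L] [Algebra K L]

/-- The vertices whose lattices are stable under multiplication by `α`. One lattice of the class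
may be tested, since multiplication by `α` commutes with homotheties. -/
def stableVertices (α : L) : Set (TreeVertex K L) :=
  {v | ∃ M : Submodule 𝒪[K] L, v.IsClassOf M ∧ ∀ x ∈ M, α * x ∈ M}

theorem mem_stableVertices_iff {α : L} {v : TreeVertex K L} {M : Submodule 𝒪[K] L}
    (hv : v.IsClassOf M) : v ∈ stableVertices α ↔ ∀ x ∈ M, α * x ∈ M := by
  refine ⟨?_, fun h => ⟨M, hv, h⟩⟩
  rintro ⟨N, hN, h⟩ x hx
  obtain ⟨c, hc, rfl⟩ := hN.exists_smul hv
  rw [mem_smul_iff hc] at hx ⊢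
  rw [← mul_smul_comm]
  exact h _ hx

theorem stableVertices_subset_smul (α : L) (a : 𝒪[K]) :
    (stableVertices α : Set (TreeVertex K L)) ⊆ stableVertices (a • α) := by
  rintro v ⟨M, hv, h⟩
  refine ⟨M, hv, fun x hx => ?_⟩
  rw [smul_mul_assoc]
  exact M.smul_mem _ (h x hx)

/-- If `αΛ ⊆ Λ` and `pΛ ⊆ Λ' ⊆ Λ`, then `pαΛ' ⊆ pΛ ⊆ Λ'`. -/
theorem mem_stableVertices_smul_of_adj {p : 𝒪[K]} (hp : Irreducible p) {α : L}
    {v w : TreeVertex K L} (hv : v ∈ stableVertices α) (hvw : (bruhatTitsTree K L).Adj v w) :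
    w ∈ stableVertices (p • α) := by
  obtain ⟨M, hM, h⟩ := hv
  obtain ⟨N, hN, h1, h2⟩ := (adj_iff_exists_lattice hp hM).1 hvw
  refine ⟨N, hN, fun x hx => ?_⟩
  rw [smul_mul_assoc]
  exact h1.le ((mem_coe_smul_iff p).2 ⟨_, h x (h2.le hx), rfl⟩)

/-- The lattices of `v` are stable under the order `𝒪ₙ = 𝒪[K][pⁿ Δ]`, and `n` is minimal with this
property. -/
def TreeVertex.HasLevel (p : 𝒪[K]) (Δ : L) (n : ℕ) (v : TreeVertex K L) : Prop :=
  v ∈ stableVertices (p ^ n • Δ) ∧ ∀ m < n, v ∉ stableVertices (p ^ m • Δ)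

variable (hL : Module.finrank K L = 2)
  (hO : (Subalgebra.toSubmodule (integers K L)).IsLattice K) {Δ : L}
  (hΔ : Algebra.adjoin 𝒪[K] {Δ} = integers K L) {p : 𝒪[K]} (hp : Irreducible p)
include hL hO hΔ hp

/-- A lattice with multiplier ring `𝒪ₙ` is `x 𝒪ₙ` for a unit `x` of `L`. Indeed `pⁿ Δ` does not act
as a scalar `c` modulo `p`: otherwise the lattice would be stable under the integral element
`p⁻¹ (pⁿ Δ - c)`, hence under `pⁿ⁻¹ Δ`. A cyclic vector of `pⁿ Δ` serves as `x`. -/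
theorem TreeVertex.HasLevel.exists_isUnit {n : ℕ} {v : TreeVertex K L} (hv : v.HasLevel p Δ n) :
    ∃ x : L, IsUnit x ∧ v.IsClassOf (Submodule.span 𝒪[K] {x, p ^ n • Δ * x}) := by
  have hp0 := coe_ne_zero_of_irreducible hp
  obtain ⟨M, hM⟩ := v.exists_isClassOf
  have hst := (mem_stableVertices_iff hM).1 hv.1
  have hΔ' := isFrame_one_of_adjoin_eq hL hO hΔ
  obtain ⟨x, hx⟩ := exists_isFrame_apply hL hp hM.isLattice
    (LinearMap.mulLeft 𝒪[K] (p ^ n • Δ)) hst (by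
      intro c
      by_contra! hc
      set β : L := (p : K)⁻¹ • (p ^ n • Δ - c • (1 : L)) with hβ
      have hpβ : p • β = p ^ n • Δ - c • (1 : L) := smul_inv_smul₀ hp0 _
      have hβM : ∀ x ∈ M, β * x ∈ M := by
        intro x hx
        have := (mem_smul_iff hp0).1 (hc x hx)
        rwa [LinearMap.mulLeft_apply, ← one_mul x, ← mul_assoc, mul_one, ← smul_mul_assoc,
          ← sub_mul, ← smul_mul_assoc] at this
      obtain ⟨a, b, hab⟩ := hΔ'.mem_iff.1
        (mem_toSubmodule_integers.2 (isIntegral_of_mul_mem hL hM.isLattice hβM))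
      have hext := hΔ'.ext (a := c + p * a) (b := p * b) (a' := 0) (b' := p ^ n) (by
        rw [zero_smul, zero_add, ← sub_add_cancel (p ^ n • Δ) (c • (1 : L)), ← hpβ, ← hab]
        module)
      rcases n with _ | n
      · rw [pow_zero] at hext
        exact hp.not_isUnit (IsUnit.of_mul_eq_one _ hext.2)
      · have hb : b = p ^ n := mul_left_cancel₀ hp.ne_zero (by rw [hext.2, pow_succ'])
        refine hv.2 n n.lt_succ_self ⟨M, hM, fun x hx => ?_⟩
        have : p ^ n • Δ * x = β * x - a • x := by
          rw [← hab, hb, add_mul, smul_mul_assoc a, one_mul, add_sub_cancel_left]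
        rw [this]
        exact M.sub_mem (hβM x hx) (M.smul_mem _ hx))
  exact ⟨x, isUnit_of_isFrame_mul hL hx, hx.eq_span ▸ hM⟩

/-- The lattice `x 𝒪ₙ` has level `n`. -/
theorem hasLevel_of_isClassOf {n : ℕ} {v : TreeVertex K L} {x : L}
    (hv : v.IsClassOf (Submodule.span 𝒪[K] {x, p ^ n • Δ * x})) : v.HasLevel p Δ n := by
  have hframe := isFrame_of_span_eq hL hv.isLattice rfl
  have hx := isUnit_of_isFrame_mul hL hframe
  have hn := isFrame_one_pow_smul hL hO hΔ hp n
  rw [← toSubmodule_mainOrder hL hO hΔ n] at hn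
  refine ⟨(mem_stableVertices_iff hv).2 fun y hy => ?_, fun m hm hvm => ?_⟩
  · obtain ⟨a, b, rfl⟩ := Submodule.mem_span_pair.1 hy
    obtain ⟨r, s, hrs⟩ := hn.mem_iff.1
      (Subalgebra.mul_mem (mainOrder p Δ n) hn.right_mem hn.right_mem)
    refine Submodule.mem_span_pair.2 ⟨b * r, a + b * s, ?_⟩
    simp only [Algebra.smul_def, map_add, map_mul] at hrs ⊢
    linear_combination algebraMap 𝒪[K] L b * x * hrs
  · have := (mem_stableVertices_iff hv).1 hvm x hframe.left_mem
    obtain ⟨a, b, hab⟩ := hframe.mem_iff.1 this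
    have := (isFrame_one_of_adjoin_eq hL hO hΔ).ext
      (a := a) (b := b * p ^ n) (a' := 0) (b' := p ^ m)
      (hx.mul_right_cancel (by
        rw [zero_smul, zero_add, ← hab]
        simp only [Algebra.smul_def, map_mul]
        ring))
    have := (pow_dvd_pow_iff hp.ne_zero hp.not_isUnit).1 (Dvd.intro_left _ this.2)
    omega

/-- The principal ideals of `𝒪ₙ` of rank two represent exactly the vertices of level `n`. -/
theorem representsPrincipalIdeal_iff_hasLevel {n : ℕ} {v : TreeVertex K L} :
    RepresentsPrincipalIdeal (mainOrder p Δ n) v ↔ v.HasLevel p Δ n := by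
  constructor
  · rintro ⟨I, ⟨y, rfl⟩, -, hv⟩
    rw [Ideal.submodule_span_eq,
      idealToSubmodule_span_singleton (toSubmodule_mainOrder hL hO hΔ n)] at hv
    exact hasLevel_of_isClassOf hL hO hΔ hp hv
  · intro hv
    obtain ⟨x, hx, hv⟩ := hv.exists_isUnit hL hO hΔ hp
    -- a multiple of `x` lies in the order
    have hn := isFrame_one_pow_smul hL hO hΔ hp n
    rw [← toSubmodule_mainOrder hL hO hΔ n] at hn
    obtain ⟨j, hj⟩ := exists_pow_smul_mem hp (hn.isLattice hL) x
    have hc : ((p : K) ^ j) ≠ 0 := pow_ne_zero _ (coe_ne_zero_of_irreducible hp)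
    let y : mainOrder p Δ n := ⟨((p : K) ^ j) • x, hj⟩
    have hv' : v.IsClassOf (idealToSubmodule (Ideal.span {y})) := by
      rw [idealToSubmodule_span_singleton (toSubmodule_mainOrder hL hO hΔ n)]
      convert hv.smul hc using 1
      rw [Submodule.smul_span, ← Set.image_smul, Set.image_pair, ← mul_smul_comm]
    refine ⟨Ideal.span {y}, ⟨y, rfl⟩, ?_, hv'⟩
    have e := Submodule.equivMapOfInjective (mainOrder p Δ n).val.toLinearMap Subtype.val_injective
      ((Ideal.span {y}).restrictScalars 𝒪[K])
    refine e.finrank_eq.trans ?_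
    have := hv'.isLattice
    change Module.finrank 𝒪[K] (idealToSubmodule (Ideal.span {y})) = 2
    rw [Module.finrank, Submodule.IsLattice.rank' K]
    exact hL

/-- A vertex `[x 𝒪ₙ₊₁]` of level `n + 1` is adjacent to the vertex `[x 𝒪ₙ]`. -/
theorem TreeVertex.HasLevel.exists_adj {n : ℕ} {v : TreeVertex K L}
    (hv : v.HasLevel p Δ (n + 1)) :
    ∃ w ∈ stableVertices (p ^ n • Δ), (bruhatTitsTree K L).Adj v w := by
  obtain ⟨x, hx, hv⟩ := hv.exists_isUnit hL hO hΔ hp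
  have hn := isFrame_mul (isFrame_one_pow_smul hL hO hΔ hp n) hx
  set M := Submodule.span 𝒪[K] {x * 1, x * (p ^ n • Δ)} with hM
  have hMlat := hn.isLattice hL
  have hv' : v.IsClassOf (lineLattice p (x * 1) 1 M) := by
    convert hv using 1
    rw [(hn.lineLattice hp 1).eq_span]
    congr 2
    · exact mul_one x
    · rw [pow_one, ← mul_smul_comm, smul_smul, ← pow_succ', mul_comm]
  obtain ⟨w, hw⟩ := exists_treeVertex_isClassOf hMlat
  refine ⟨w, ?_, ?_⟩
  · refine (hasLevel_of_isClassOf hL hO hΔ hp (x := x) ?_).1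
    convert hw using 1
    rw [hM, mul_one, mul_comm]
  · exact adj_lineLattice hL hp hMlat hn.left_mem (hn.left_notMem hp) hv'
      (by rwa [lineLattice_zero p hn.left_mem])

/-- If the basin consists of the vertices of level zero, then its `n`-th neighbourhood consists of
the vertices of level at most `n`: the level changes by at most one along an edge, and every vertex
of positive level has a neighbour of smaller level. -/
theorem basinFiltration_eq_stableVertices {P : Set (TreeVertex K L)} (hP : P = stableVertices Δ)
    (n : ℕ) : basinFiltration (bruhatTitsTree K L) P n = stableVertices (p ^ n • Δ) := by
  induction n with
  | zero => rw [pow_zero, one_smul, ← hP]; rfl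
  | succ n ih =>
    ext v
    change (∃ w ∈ basinFiltration (bruhatTitsTree K L) P n, _) ↔ _
    rw [ih]
    constructor
    · rintro ⟨w, hw, hvw⟩
      rw [SimpleGraph.edist_le_one_iff_adj_or_eq] at hvw
      rw [pow_succ', mul_smul]
      rcases hvw with hvw | rfl
      · exact mem_stableVertices_smul_of_adj hp hw hvw.symm
      · exact stableVertices_subset_smul _ _ hw
    · intro hv
      by_cases hvn : v ∈ stableVertices (p ^ n • Δ)
      · exact ⟨v, hvn, by simp⟩
      · have hlevel : v.HasLevel p Δ (n + 1) := by
          refine ⟨hv, fun m hm hvm => hvn ?_⟩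
          obtain ⟨k, rfl⟩ := Nat.exists_eq_add_of_le (Nat.lt_succ_iff.1 hm)
          rw [add_comm, pow_add, mul_smul]
          exact stableVertices_subset_smul _ _ hvm
        obtain ⟨w, hw, hvw⟩ := hlevel.exists_adj hL hO hΔ hp
        exact ⟨w, hw, SimpleGraph.edist_le_one_iff_adj_or_eq.2 (Or.inl hvw)⟩

theorem representsPrincipalIdeal_iff_mem_layer {P : Set (TreeVertex K L)}
    (hP : P = stableVertices Δ) (n : ℕ) (v : TreeVertex K L) :
    RepresentsPrincipalIdeal (mainOrder p Δ n) v ↔ v ∈ layer (bruhatTitsTree K L) P n := by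
  rw [representsPrincipalIdeal_iff_hasLevel hL hO hΔ hp]
  rcases n with _ | n
  · change _ ↔ v ∈ P
    rw [hP, TreeVertex.HasLevel, pow_zero, one_smul]
    simp
  · change _ ↔ v ∈ basinFiltration _ P (n + 1) \ basinFiltration _ P n
    rw [basinFiltration_eq_stableVertices hL hO hΔ hp hP,
      basinFiltration_eq_stableVertices hL hO hΔ hp hP]
    refine ⟨fun h => ⟨h.1, h.2 n n.lt_succ_self⟩, fun h => ⟨h.1, fun m hm hvm => h.2 ?_⟩⟩
    obtain ⟨k, rfl⟩ := Nat.exists_eq_add_of_le (Nat.lt_succ_iff.1 hm)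
    rw [add_comm, pow_add, mul_smul]
    exact stableVertices_subset_smul _ _ hvm

/-- The vertices of level zero are the classes of the lattices `x 𝒪_L`. -/
theorem mem_stableVertices_iff_exists_isUnit {v : TreeVertex K L} :
    v ∈ stableVertices Δ ↔ ∃ x : L, IsUnit x ∧ v.IsClassOf (Submodule.span 𝒪[K] {x, Δ * x}) := by
  have h : v ∈ stableVertices Δ ↔ v.HasLevel p Δ 0 := by
    rw [TreeVertex.HasLevel, pow_zero, one_smul]
    simp
  rw [h]
  constructor
  · intro hv
    simpa only [pow_zero, one_smul] using hv.exists_isUnit hL hO hΔ hp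
  · rintro ⟨x, -, hv⟩
    refine hasLevel_of_isClassOf hL hO hΔ hp (x := x) ?_
    rwa [pow_zero, one_smul]

end Levels

/-! ### Quadratic algebras: fields and the split algebra -/

section QuadraticAlgebras

set_option linter.unusedSectionVars false

variable {K : Type*} [Field K] [ValuativeRel K] [TopologicalSpace K] [IsNonarchimedeanLocalField K]
variable {L : Type*} [CommRing L] [Algebra K L]

theorem exists_eq_algebraMap_or_mul_self_eq (hL : Module.finrank K L = 2) (x : L) :
    (∃ k : K, x = algebraMap K L k) ∨ ∃ r s : K, x * x = r • (1 : L) + s • x := by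
  have := nontrivial_of_finrank_eq_two hL
  by_cases h : ∃ k : K, k • (1 : L) = x
  · obtain ⟨k, rfl⟩ := h
    exact Or.inl ⟨k, (Algebra.algebraMap_eq_smul_one k).symm⟩
  · right
    have hli : LinearIndependent K ![1, x] :=
      (LinearIndependent.pair_iff' one_ne_zero).2 (not_exists.1 h)
    have : FiniteDimensional K L := Module.finite_of_finrank_eq_succ hL
    have hs := hli.span_eq_top_of_card_eq_finrank' (by simp [hL])
    rw [Matrix.range_cons, Matrix.range_cons, Matrix.range_empty, Set.union_empty,
      Set.singleton_union] at hs
    obtain ⟨r, s, hrs⟩ := Submodule.mem_span_pair.1 (hs ▸ Submodule.mem_top : x * x ∈ _)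
    exact ⟨r, s, hrs.symm⟩

/-- A reduced quadratic algebra that is not a field is split: a non-invertible `a ≠ 0` satisfies
`a² = s a` with `s ≠ 0`, so that `s⁻¹ a` is a non-trivial idempotent. -/
theorem isSplitCase_of_not_isField [IsReduced L] (hL : Module.finrank K L = 2)
    (hF : ¬ IsField L) : IsSplitCase K L := by
  have := nontrivial_of_finrank_eq_two hL
  have : FiniteDimensional K L := Module.finite_of_finrank_eq_succ hL
  obtain ⟨a, ha0, ha⟩ : ∃ a : L, a ≠ 0 ∧ ∀ b, a * b ≠ 1 := by
    by_contra! h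
    exact hF ⟨⟨0, 1, zero_ne_one⟩, mul_comm, fun {a} ha => h a ha⟩
  obtain ⟨s, hs, has⟩ : ∃ s : K, s ≠ 0 ∧ a * a = s • a := by
    rcases exists_eq_algebraMap_or_mul_self_eq hL a with ⟨k, rfl⟩ | ⟨r, s, h⟩
    · have hk : k ≠ 0 := fun hk => ha0 (by rw [hk, map_zero])
      exact absurd (by rw [← map_mul, mul_inv_cancel₀ hk, map_one]) (ha (algebraMap K L k⁻¹))
    · have hr : r = 0 := by
        by_contra hr
        refine ha (r⁻¹ • (a - s • 1)) ?_
        rw [mul_smul_comm, mul_sub, h, mul_smul_comm, mul_one, add_sub_cancel_right,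
          inv_smul_smul₀ hr]
      rw [hr, zero_smul, zero_add] at h
      refine ⟨s, ?_, h⟩
      rintro rfl
      rw [zero_smul] at h
      exact ha0 (IsReduced.eq_zero a ⟨2, by rw [pow_two, h]⟩)
  set e : L := s⁻¹ • a with he
  have hee : e * e = e := by
    rw [he, smul_mul_smul_comm, has, smul_smul, mul_assoc, inv_mul_cancel₀ hs, mul_one]
  have he0 : e ≠ 0 := smul_ne_zero (inv_ne_zero hs) ha0
  have he1 : 1 - e ≠ 0 := by
    intro h
    refine ha (s⁻¹ • 1) ?_
    rw [mul_smul_comm, mul_one, ← he]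
    exact (sub_eq_zero.1 h).symm
  let f : K × K →ₗ[K] L :=
    (LinearMap.toSpanSingleton K L e).coprod (LinearMap.toSpanSingleton K L (1 - e))
  have hf : ∀ x, f x = x.1 • e + x.2 • (1 - e) := fun x => rfl
  let g : K × K →ₐ[K] L := AlgHom.ofLinearMap f
    (by rw [hf, Prod.fst_one, Prod.snd_one, one_smul, one_smul, add_sub_cancel]) (by
      intro x y
      simp only [hf, Prod.fst_mul, Prod.snd_mul, Algebra.smul_def, map_mul]
      linear_combination (-(algebraMap K L x.1 - algebraMap K L x.2) *
        (algebraMap K L y.1 - algebraMap K L y.2)) * hee)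
  have hinj : Function.Injective f := by
    rw [← LinearMap.ker_eq_bot, LinearMap.ker_eq_bot']
    intro x hx
    rw [hf] at hx
    have h1 : x.1 • e = 0 := by
      have : (x.1 • e + x.2 • (1 - e)) * e = x.1 • e := by
        rw [add_mul, smul_mul_assoc x.1, smul_mul_assoc x.2, sub_mul, one_mul, hee, sub_self,
          smul_zero, add_zero]
      rw [← this, hx, zero_mul]
    rw [h1, zero_add] at hx
    exact Prod.ext ((smul_eq_zero.1 h1).resolve_right he0) ((smul_eq_zero.1 hx).resolve_right he1)
  have hbij : Function.Bijective g :=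
    ⟨hinj, (LinearMap.injective_iff_surjective_of_finrank_eq_finrank
      (by rw [hL, Module.finrank_prod, Module.finrank_self])).1 hinj⟩
  exact ⟨(AlgEquiv.ofBijective g hbij).symm⟩

end QuadraticAlgebras

/-! ### The ring of integers of the split algebra -/

section Split

set_option linter.unusedSectionVars false

variable {K : Type*} [Field K] [ValuativeRel K] [TopologicalSpace K] [IsNonarchimedeanLocalField K]
variable {L : Type*} [CommRing L] [Algebra K L]

theorem symm_prod_smul (e : L ≃ₐ[K] K × K) (a b : 𝒪[K]) (x y : K) :
    e.symm ((a : K) * x, (b : K) * y) = a • e.symm (x, 0) + b • e.symm (0, y) := by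
  change _ = (a : K) • e.symm (x, 0) + (b : K) • e.symm (0, y)
  rw [← map_smul, ← map_smul, ← map_add]
  simp

theorem isIntegral_iff_mem_prod (e : L ≃ₐ[K] K × K) {x : L} :
    IsIntegral 𝒪[K] x ↔ ∃ a b : 𝒪[K], e x = ((a : K), (b : K)) := by
  have hint : ∀ c : K, IsIntegral 𝒪[K] c ↔ ∃ a : 𝒪[K], (a : K) = c := fun c =>
    IsIntegrallyClosed.isIntegral_iff
  constructor
  · intro hx
    obtain ⟨a, ha⟩ := (hint _).1
      (hx.map (((AlgHom.fst K K K).comp e.toAlgHom).restrictScalars 𝒪[K]))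
    obtain ⟨b, hb⟩ := (hint _).1
      (hx.map (((AlgHom.snd K K K).comp e.toAlgHom).restrictScalars 𝒪[K]))
    exact ⟨a, b, Prod.ext ha.symm hb.symm⟩
  · rintro ⟨a, b, hab⟩
    have : IsIntegral 𝒪[K] (e x) := by
      rw [hab]
      exact ((hint _).2 ⟨a, rfl⟩).pair ((hint _).2 ⟨b, rfl⟩)
    simpa using this.map (e.symm.toAlgHom.restrictScalars 𝒪[K])

theorem isFrame_split (e : L ≃ₐ[K] K × K) :
    IsFrame (e.symm (1, 0)) (e.symm (0, 1)) (Subalgebra.toSubmodule (integers K L)) := by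
  refine ⟨?_, ?_⟩
  · rw [LinearIndependent.pair_iff]
    intro s t h
    rw [← map_smul, ← map_smul, ← map_add, EmbeddingLike.map_eq_zero_iff] at h
    simpa using h
  · ext x
    rw [mem_toSubmodule_integers, isIntegral_iff_mem_prod e, Submodule.mem_span_pair]
    refine exists_congr fun a => exists_congr fun b => ?_
    rw [← symm_prod_smul, AlgEquiv.symm_apply_eq, mul_one, mul_one, eq_comm]

end Split

/-! ### The ring of integers of a quadratic field extension -/

section QuadraticFields

set_option linter.unusedSectionVars false

variable {K : Type*} [Field K] [ValuativeRel K] [TopologicalSpace K] [IsNonarchimedeanLocalField K]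
variable {L : Type*} [CommRing L] [Algebra K L]

theorem isLattice_integers_of_isField [CharZero K] (hL : Module.finrank K L = 2) (hF : IsField L) :
    (Subalgebra.toSubmodule (integers K L)).IsLattice K := by
  have : FiniteDimensional K L := Module.finite_of_finrank_eq_succ hL
  have hnoeth : IsNoetherian 𝒪[K] (integers K L) := by
    let := hF.toField
    exact IsIntegralClosure.isNoetherian 𝒪[K] K L (integralClosure 𝒪[K] L)
  refine ⟨Module.Finite.iff_fg.1 (inferInstanceAs (Module.Finite 𝒪[K] (integers K L))), ?_⟩
  rw [eq_top_iff]
  intro x _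
  obtain ⟨a, ha, hx⟩ := ((IsFractionRing.isAlgebraic_iff 𝒪[K] K L).2
    (Algebra.IsAlgebraic.isAlgebraic x)).exists_integral_multiple
  have ha' : (a : K) ≠ 0 := fun h => ha (Subtype.ext h)
  rw [← inv_smul_smul₀ ha' x]
  exact Submodule.smul_mem _ _ (Submodule.subset_span hx)

/-- Hensel's lemma for `Y² - Y + c` with `c` in the maximal ideal. -/
theorem exists_mul_self_sub_self_add_eq_zero {c : 𝒪[K]} (hc : c ∈ 𝓂[K]) :
    ∃ a : 𝒪[K], a * a - a + c = 0 := by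
  let := IsTopologicalAddGroup.rightUniformSpace K
  have := isUniformAddGroup_of_addCommGroup (G := K)
  have : HenselianRing 𝒪[K] 𝓂[K] := inferInstance
  open Polynomial in
  obtain ⟨a, ha, -⟩ := this.is_henselian (X ^ 2 + (C (-1) * X + C c))
    ((monic_X_pow 2).add_of_left
      (by rw [degree_X_pow]; exact degree_linear_lt_degree_C_mul_X_sq (a := 1) one_ne_zero
            |>.trans_le (by simp))) 0 (by simpa using hc) (by simp)
  refine ⟨a, ?_⟩
  simp only [Polynomial.IsRoot, Polynomial.eval_add, Polynomial.eval_pow, Polynomial.eval_mul,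
    Polynomial.eval_X, Polynomial.eval_C] at ha
  linear_combination ha

theorem exists_coe_eq_or_exists_coe_mem_maximalIdeal (k : K) :
    (∃ a : 𝒪[K], (a : K) = k) ∨ ∃ a ∈ 𝓂[K], (a : K) * k = 1 := by
  obtain ⟨p, hp⟩ := IsDiscreteValuationRing.exists_irreducible 𝒪[K]
  have hp0 := coe_ne_zero_of_irreducible hp
  rcases eq_or_ne k 0 with rfl | hk
  · exact Or.inl ⟨0, rfl⟩
  obtain ⟨n, u, rfl⟩ := exists_zpow_mul_unit hp hk
  rcases lt_or_ge n 0 with hn | hn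
  · right
    obtain ⟨m, hm⟩ := Int.eq_succ_of_zero_lt (neg_pos.2 hn)
    refine ⟨p ^ (m + 1) * ↑u⁻¹, ?_, ?_⟩
    · rw [hp.maximalIdeal_eq, Ideal.mem_span_singleton, pow_succ', mul_assoc]
      exact dvd_mul_right _ _
    · have hu : (((u⁻¹ : 𝒪[K]ˣ) : 𝒪[K]) : K) * ((u : 𝒪[K]) : K) = 1 :=
        congrArg Subtype.val (Units.inv_mul u)
      obtain rfl : n = -((m + 1 : ℕ) : ℤ) := by push_cast; omega
      rw [zpow_neg, zpow_natCast]
      change (p : K) ^ (m + 1) * (((u⁻¹ : 𝒪[K]ˣ) : 𝒪[K]) : K) * _ = 1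
      rw [mul_mul_mul_comm, mul_inv_cancel₀ (pow_ne_zero _ hp0), one_mul, hu]
  · left
    obtain ⟨m, rfl⟩ := Int.eq_ofNat_of_zero_le hn
    exact ⟨p ^ m * u, by rw [zpow_natCast]; rfl⟩

theorem isIntegral_or_isIntegral_of_eq_algebraMap {k : K} {y : L}
    (hxy : algebraMap K L k * y = 1) : IsIntegral 𝒪[K] (algebraMap K L k) ∨ IsIntegral 𝒪[K] y := by
  rcases exists_coe_eq_or_exists_coe_mem_maximalIdeal k with ⟨a, rfl⟩ | ⟨a, -, ha⟩
  · exact Or.inl (isIntegral_algebraMap (R := 𝒪[K]) (x := a))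
  · right
    have : y = algebraMap 𝒪[K] L a := by
      have h : algebraMap K L (a : K) * algebraMap K L k = 1 := by rw [← map_mul, ha, map_one]
      calc y = (algebraMap K L (a : K) * algebraMap K L k) * y := by rw [h, one_mul]
        _ = algebraMap K L a := by rw [mul_assoc, hxy, mul_one]
    rw [this]
    exact isIntegral_algebraMap

/-- If `x² = s x + r` with `r` integral but `s` not, then `x` lies in `K`: by Hensel's lemma the
equation of `x / s` has a root in `𝒪[K]`. -/
theorem isIntegral_or_isIntegral_of_mul_self_eq (hF : IsField L) {x y : L} (hxy : x * y = 1)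
    {r : 𝒪[K]} {s : K} (h : x * x = r • (1 : L) + s • x) :
    IsIntegral 𝒪[K] x ∨ IsIntegral 𝒪[K] y := by
  have := hF.isDomain
  rcases exists_coe_eq_or_exists_coe_mem_maximalIdeal s with ⟨s, rfl⟩ | ⟨a, ham, ha⟩
  · left
    refine IsIntegral.of_mem_of_fg (Algebra.adjoin 𝒪[K] {x}) ?_ x
      (Algebra.self_mem_adjoin_singleton _ _)
    rw [toSubmodule_adjoin_singleton (s := s) h]
    exact Submodule.fg_span (Set.toFinite _)
  · obtain ⟨b, hb⟩ := exists_mul_self_sub_self_add_eq_zero (c := -(r * a * a))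
      (neg_mem (Ideal.mul_mem_left _ _ ham))
    have hb' := congrArg (algebraMap 𝒪[K] L) hb
    have ha' : algebraMap 𝒪[K] L a * algebraMap K L s = 1 := by
      change algebraMap K L (a : K) * _ = 1
      rw [← map_mul, ha, map_one]
    rw [Algebra.smul_def, Algebra.smul_def, mul_one] at h
    simp only [map_add, map_sub, map_mul, map_neg, map_zero] at hb'
    have hprod : (algebraMap 𝒪[K] L a * x - algebraMap 𝒪[K] L b) *
        (algebraMap 𝒪[K] L a * x - 1 + algebraMap 𝒪[K] L b) = 0 := by
      linear_combination (algebraMap 𝒪[K] L a) ^ 2 * h +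
        algebraMap 𝒪[K] L a * x * ha' - hb'
    have hx : x = algebraMap K L s * (algebraMap 𝒪[K] L a * x) := by
      rw [← mul_assoc, mul_comm (algebraMap K L s), ha', one_mul]
    obtain ⟨k, hk⟩ : ∃ k : K, x = algebraMap K L k := by
      rcases mul_eq_zero.1 hprod with h0 | h0
      · refine ⟨s * b, ?_⟩
        rw [hx, map_mul, sub_eq_zero.1 h0]
        rfl
      · refine ⟨s * (1 - b), ?_⟩
        rw [hx, map_mul, map_sub, map_one]
        congr 1
        change _ = 1 - algebraMap 𝒪[K] L b
        linear_combination h0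
    rw [hk] at hxy ⊢
    exact isIntegral_or_isIntegral_of_eq_algebraMap hxy

/-- The ring of integers of a quadratic field extension is a valuation ring. -/
theorem isIntegral_or_isIntegral_of_mul_eq_one (hL : Module.finrank K L = 2) (hF : IsField L)
    {x y : L} (hxy : x * y = 1) : IsIntegral 𝒪[K] x ∨ IsIntegral 𝒪[K] y := by
  rcases exists_eq_algebraMap_or_mul_self_eq hL x with ⟨k, rfl⟩ | ⟨r, s, h⟩
  · exact isIntegral_or_isIntegral_of_eq_algebraMap hxy
  rcases exists_coe_eq_or_exists_coe_mem_maximalIdeal r with ⟨r, rfl⟩ | ⟨a, -, ha⟩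
  · exact isIntegral_or_isIntegral_of_mul_self_eq hF hxy h
  · refine (isIntegral_or_isIntegral_of_mul_self_eq hF (r := a) (s := -(a : K) * s)
      ((mul_comm y x).trans hxy) ?_).symm
    have ha' : algebraMap K L (a : K) * algebraMap K L r = 1 := by rw [← map_mul, ha, map_one]
    change y * y = (a : K) • (1 : L) + _
    simp only [Algebra.smul_def, map_mul, map_neg, mul_one] at h ⊢
    have h2 : (x * x) * (y * y) = 1 := by rw [mul_mul_mul_comm, hxy, one_mul]
    have h3 : 1 = algebraMap K L r * (y * y) + algebraMap K L s * y := by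
      calc 1 = (x * x) * (y * y) := h2.symm
        _ = algebraMap K L r * (y * y) + algebraMap K L s * y * (x * y) := by rw [h]; ring
        _ = _ := by rw [hxy, mul_one]
    linear_combination -(y * y) * ha' - algebraMap K L (a : K) * h3

theorem isDiscreteValuationRing_integers (hL : Module.finrank K L = 2) (hF : IsField L)
    (hO : (Subalgebra.toSubmodule (integers K L)).IsLattice K) [IsDomain L] :
    IsDiscreteValuationRing (integers K L) := by
  have : ValuationRing (integers K L) := by
    have : PreValuationRing (integers K L) := by
      constructor
      intro a b
      by_cases ha : a = 0
      · exact ⟨0, Or.inr (by rw [ha, mul_zero])⟩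
      by_cases hb : b = 0
      · exact ⟨0, Or.inl (by rw [hb, mul_zero])⟩
      obtain ⟨c, hc⟩ := hF.mul_inv_cancel fun h => ha (Subtype.ext h)
      obtain ⟨d, hd⟩ := hF.mul_inv_cancel fun h => hb (Subtype.ext h)
      rcases isIntegral_or_isIntegral_of_mul_eq_one hL hF (x := b * c) (y := a * d)
        (by linear_combination (b * d : L) * hc + hd) with h | h
      · refine ⟨⟨_, h⟩, Or.inl (Subtype.ext ?_)⟩
        change (a : L) * (b * c) = b
        linear_combination (b : L) * hc
      · refine ⟨⟨_, h⟩, Or.inr (Subtype.ext ?_)⟩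
        change (b : L) * (a * d) = a
        linear_combination (a : L) * hd
    constructor
  have : Module.Finite 𝒪[K] (integers K L) :=
    inferInstanceAs (Module.Finite 𝒪[K] (Subalgebra.toSubmodule (integers K L)))
  have : IsNoetherianRing (integers K L) :=
    isNoetherian_of_tower 𝒪[K] (inferInstance : IsNoetherian 𝒪[K] (integers K L))
  have : IsPrincipalIdealRing (integers K L) :=
    IsPrincipalIdealRing.of_isNoetherianRing_of_isBezout
  refine ⟨fun h => ?_⟩
  obtain ⟨p, hp⟩ := IsDiscreteValuationRing.exists_irreducible 𝒪[K]
  have hunit : ¬ IsUnit (algebraMap 𝒪[K] (integers K L) p) := by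
    intro hu
    obtain ⟨y, hy⟩ := hu.exists_right_inv
    refine one_notMem_smul_integers hL hp ((mem_coe_smul_iff p).2 ⟨y, y.2, ?_⟩)
    rw [Algebra.smul_def]
    exact congrArg Subtype.val hy
  have hmem := (IsLocalRing.mem_maximalIdeal _).2 (mem_nonunits_iff.2 hunit)
  rw [h, Ideal.mem_bot] at hmem
  have h0 : algebraMap K L (p : K) = 0 := congrArg Subtype.val hmem
  exact coe_ne_zero_of_irreducible hp ((map_eq_zero_iff _ (algebraMap K L).injective).1 h0)

end QuadraticFields

/-! ### Basins in the field cases -/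

section FieldBasins

set_option linter.unusedSectionVars false

variable {K : Type*} [Field K] [ValuativeRel K] [TopologicalSpace K] [IsNonarchimedeanLocalField K]
variable {L : Type*} [CommRing L] [Algebra K L]

theorem idealToSubmodule_le_iff {O : Subalgebra 𝒪[K] L} {I J : Ideal O} :
    idealToSubmodule I ≤ idealToSubmodule J ↔ I ≤ J :=
  Submodule.map_le_map_iff_of_injective (f := O.val.toLinearMap) Subtype.val_injective _ _

theorem idealToSubmodule_lt_iff {O : Subalgebra 𝒪[K] L} {I J : Ideal O} :
    idealToSubmodule I < idealToSubmodule J ↔ I < J := by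
  simp only [lt_iff_le_not_ge, idealToSubmodule_le_iff]

theorem idealToSubmodule_top (O : Subalgebra 𝒪[K] L) :
    idealToSubmodule (⊤ : Ideal O) = Subalgebra.toSubmodule O := by
  ext x
  exact ⟨fun ⟨y, _, hy⟩ => hy ▸ y.2, fun hx => ⟨⟨x, hx⟩, trivial, rfl⟩⟩

theorem idealToSubmodule_span_algebraMap_mul {O : Subalgebra 𝒪[K] L} (a : 𝒪[K]) (y : O) :
    idealToSubmodule (Ideal.span {algebraMap 𝒪[K] O a * y})
      = (a : K) • idealToSubmodule (Ideal.span {y}) := by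
  ext x
  rw [mem_coe_smul_iff]
  constructor
  · rintro ⟨z, hz, rfl⟩
    obtain ⟨c, rfl⟩ := Ideal.mem_span_singleton'.1
      (show z ∈ Ideal.span {algebraMap 𝒪[K] O a * y} from hz)
    refine ⟨_, ⟨c * y, Ideal.mul_mem_left _ _ (Ideal.mem_span_singleton_self y), rfl⟩, ?_⟩
    rw [← map_smul, Algebra.smul_def, mul_left_comm]
  · rintro ⟨_, ⟨z, hz, rfl⟩, rfl⟩
    obtain ⟨c, rfl⟩ := Ideal.mem_span_singleton'.1 (show z ∈ Ideal.span {y} from hz)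
    refine ⟨c * (algebraMap 𝒪[K] O a * y),
      Ideal.mul_mem_left _ _ (Ideal.mem_span_singleton_self _), ?_⟩
    rw [← map_smul, Algebra.smul_def, mul_left_comm]

variable (hL : Module.finrank K L = 2) [IsDomain L] [IsDiscreteValuationRing (integers K L)]
  (hO : (Subalgebra.toSubmodule (integers K L)).IsLattice K)
  {p : 𝒪[K]} (hp : Irreducible p) {ϖ : integers K L} (hϖ : Irreducible ϖ)
include hL hO hp hϖ

/-- The ramification index is at most two, because there is no chain of three proper inclusions
from `p 𝒪_L` to `𝒪_L`. -/
theorem exists_associated_pow : ∃ j, 0 < j ∧ j ≤ 2 ∧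
    Associated (algebraMap 𝒪[K] (integers K L) p) (ϖ ^ j) ∧
    ∀ P : Ideal (integers K L), P.IsMaximal → Ideal.ramificationIdx' 𝓂[K] P = j := by
  have hp0 : algebraMap 𝒪[K] (integers K L) p ≠ 0 := by
    intro h
    have h0 : algebraMap K L (p : K) = 0 := congrArg Subtype.val h
    exact coe_ne_zero_of_irreducible hp ((map_eq_zero_iff _ (algebraMap K L).injective).1 h0)
  obtain ⟨j, hj⟩ := IsDiscreteValuationRing.associated_pow_irreducible hp0 hϖ
  have hlt : ∀ {i k : ℕ}, i < k → Ideal.span {ϖ ^ k} < Ideal.span {ϖ ^ i} := by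
    intro i k hik
    rw [lt_iff_le_not_ge, Ideal.span_singleton_le_span_singleton,
      Ideal.span_singleton_le_span_singleton, pow_dvd_pow_iff hϖ.ne_zero hϖ.not_isUnit,
      pow_dvd_pow_iff hϖ.ne_zero hϖ.not_isUnit]
    omega
  have hspan : Ideal.span {algebraMap 𝒪[K] (integers K L) p} = Ideal.span {ϖ ^ j} :=
    Ideal.span_singleton_eq_span_singleton.2 hj
  have htop : Subalgebra.toSubmodule (integers K L) = idealToSubmodule (Ideal.span {ϖ ^ 0}) := by
    rw [pow_zero, Ideal.span_singleton_one, idealToSubmodule_top]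
  have hpO : (p : K) • Subalgebra.toSubmodule (integers K L)
      = idealToSubmodule (Ideal.span {ϖ ^ j}) := by
    rw [htop, ← idealToSubmodule_span_algebraMap_mul, pow_zero, mul_one, hspan]
  refine ⟨j, Nat.pos_of_ne_zero ?_, ?_, hj, ?_⟩
  · rintro rfl
    refine one_notMem_smul_integers hL hp ?_
    rw [hpO, ← htop]
    exact Subalgebra.one_mem _
  · by_contra! hj2
    have h1 : (p : K) • Subalgebra.toSubmodule (integers K L)
        < idealToSubmodule (Ideal.span {ϖ ^ 2}) := by
      rw [hpO, idealToSubmodule_lt_iff]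
      exact hlt hj2
    have h2 : idealToSubmodule (Ideal.span {ϖ ^ 2}) < idealToSubmodule (Ideal.span {ϖ ^ 1}) :=
      idealToSubmodule_lt_iff.2 (hlt one_lt_two)
    have h3 : idealToSubmodule (Ideal.span {ϖ ^ 1}) < Subalgebra.toSubmodule (integers K L) := by
      rw [htop, idealToSubmodule_lt_iff]
      exact hlt one_pos
    exact h2.ne (eq_of_le_of_between hL hp hO h1 h2.le h3)
  · intro P hP
    have hmap : Ideal.map (algebraMap 𝒪[K] (integers K L)) 𝓂[K] = Ideal.span {ϖ ^ j} := by
      rw [hp.maximalIdeal_eq, Ideal.map_span, Set.image_singleton, hspan]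
    have hPow : ∀ n, P ^ n = Ideal.span {ϖ ^ n} := fun n => by
      rw [IsLocalRing.eq_maximalIdeal hP, hϖ.maximalIdeal_eq, Ideal.span_singleton_pow]
    refine Ideal.ramificationIdx'_spec ?_ ?_
    · rw [hmap, hPow]
    · rw [hmap, hPow]
      exact (hlt j.lt_succ_self).not_ge

/-- If `p` is a unit times `ϖʲ`, then the vertices of level zero are the classes of the ideals
`ϖʳ 𝒪_L` with `r < j`. -/
theorem mem_stableVertices_iff_exists_pow {Δ : L}
    (hΔ : Algebra.adjoin 𝒪[K] {Δ} = integers K L) {j : ℕ} (hj0 : 0 < j)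
    (hj : Associated (algebraMap 𝒪[K] (integers K L) p) (ϖ ^ j)) {v : TreeVertex K L} :
    v ∈ stableVertices Δ ↔ ∃ r < j, v.IsClassOf (idealToSubmodule (Ideal.span {ϖ ^ r})) := by
  have hspan := idealToSubmodule_span_singleton (isFrame_one_of_adjoin_eq hL hO hΔ).eq_span
  have hp0 := coe_ne_zero_of_irreducible hp
  rw [mem_stableVertices_iff_exists_isUnit hL hO hΔ hp]
  constructor
  · rintro ⟨x, hx, hv⟩
    obtain ⟨k, hk⟩ := exists_pow_smul_mem hp hO x
    let y : integers K L := ⟨p ^ k • x, hk⟩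
    have hy0 : y ≠ 0 := by
      intro h
      have h0 : ((p : K) ^ k) • x = 0 := congrArg Subtype.val h
      rw [smul_eq_zero_iff_right (pow_ne_zero _ hp0)] at h0
      exact hx.ne_zero h0
    obtain ⟨i, hi⟩ := IsDiscreteValuationRing.associated_pow_irreducible hy0 hϖ
    have hvy : v.IsClassOf (idealToSubmodule (Ideal.span {ϖ ^ i})) := by
      rw [← Ideal.span_singleton_eq_span_singleton.2 hi, hspan]
      convert hv.smul (pow_ne_zero k hp0) using 1
      rw [Submodule.smul_span, ← Set.image_smul, Set.image_pair, ← mul_smul_comm]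
      rfl
    refine ⟨i % j, Nat.mod_lt _ hj0, TreeVertex.IsClassOf.of_smul (pow_ne_zero (i / j) hp0) ?_⟩
    rw [← SubmonoidClass.coe_pow, ← idealToSubmodule_span_algebraMap_mul, map_pow]
    convert hvy using 2
    rw [Ideal.span_singleton_eq_span_singleton]
    have := (hj.pow_pow (n := i / j)).mul_right (ϖ ^ (i % j))
    rwa [← pow_mul, ← pow_add, Nat.div_add_mod] at this
  · rintro ⟨r, -, hv⟩
    rw [hspan] at hv
    exact ⟨_, isUnit_of_isFrame_mul hL (isFrame_of_span_eq hL hv.isLattice rfl), hv⟩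

theorem unramifiedBasin_eq_stableVertices {Δ : L}
    (hΔ : Algebra.adjoin 𝒪[K] {Δ} = integers K L)
    (hj : Associated (algebraMap 𝒪[K] (integers K L) p) (ϖ ^ 1)) :
    unramifiedBasin K L = stableVertices Δ := by
  ext v
  rw [mem_stableVertices_iff_exists_pow hL hO hp hϖ hΔ one_pos hj]
  simp [unramifiedBasin, Ideal.span_singleton_one, idealToSubmodule_top]

theorem ramifiedBasin_eq_stableVertices {Δ : L}
    (hΔ : Algebra.adjoin 𝒪[K] {Δ} = integers K L)
    (hj : Associated (algebraMap 𝒪[K] (integers K L) p) (ϖ ^ 2)) :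
    ramifiedBasin ϖ = stableVertices Δ := by
  ext v
  rw [mem_stableVertices_iff_exists_pow hL hO hp hϖ hΔ two_pos hj]
  constructor
  · rintro (hv | hv)
    · exact ⟨0, two_pos, by rwa [pow_zero, Ideal.span_singleton_one, idealToSubmodule_top]⟩
    · exact ⟨1, one_lt_two, by rwa [pow_one]⟩
  · rintro ⟨r, hr, hv⟩
    interval_cases r
    · left
      rwa [pow_zero, Ideal.span_singleton_one, idealToSubmodule_top] at hv
    · right
      rwa [pow_one] at hv

theorem isRamifiedImpactedBuilding_ramifiedBasin
    (hj : Associated (algebraMap 𝒪[K] (integers K L) p) (ϖ ^ 2)) :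
    IsRamifiedImpactedBuilding (bruhatTitsTree K L) (ramifiedBasin ϖ) (Nat.card 𝓀[K]) := by
  have hp0 := coe_ne_zero_of_irreducible hp
  obtain ⟨v, hv⟩ := exists_treeVertex_isClassOf hO
  have hpO : (p : K) • Subalgebra.toSubmodule (integers K L)
      = idealToSubmodule (Ideal.span {ϖ ^ 2}) := by
    rw [← idealToSubmodule_top, ← Ideal.span_singleton_one, ← idealToSubmodule_span_algebraMap_mul,
      mul_one, Ideal.span_singleton_eq_span_singleton.2 hj]
  have h1 : (p : K) • Subalgebra.toSubmodule (integers K L)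
      < idealToSubmodule (Ideal.span {ϖ}) := by
    rw [hpO, idealToSubmodule_lt_iff, Ideal.span_singleton_lt_span_singleton, pow_two]
    exact ⟨hϖ.ne_zero, ϖ, hϖ.not_isUnit, rfl⟩
  have h2 : idealToSubmodule (Ideal.span {ϖ}) < Subalgebra.toSubmodule (integers K L) := by
    rw [← idealToSubmodule_top, idealToSubmodule_lt_iff, lt_top_iff_ne_top, ne_eq,
      Ideal.span_singleton_eq_top]
    exact hϖ.not_isUnit
  have hϖO : (idealToSubmodule (Ideal.span {ϖ})).IsLattice K := by
    obtain ⟨u, hu, hu'⟩ := SetLike.exists_of_lt h1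
    rw [eq_lineLattice_one hL hp hO h1.le h2 hu hu']
    exact isLattice_lineLattice hL hp hO (h2.le hu) hu' 1
  obtain ⟨w, hw⟩ := exists_treeVertex_isClassOf hϖO
  refine ⟨bruhatTitsTree_isHomogeneousTree hL hp, v, w,
    (adj_iff_exists_lattice hp hv).2 ⟨_, hw, h1, h2⟩, ?_⟩
  ext x
  constructor
  · rintro (hx | hx)
    exacts [Or.inl (hx.eq hv), Or.inr (hx.eq hw)]
  · rintro (rfl | rfl)
    exacts [Or.inl hv, Or.inr hw]

omit hϖ [IsDomain L] [IsDiscreteValuationRing (integers K L)] in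
theorem isUnramifiedImpactedBuilding_unramifiedBasin :
    IsUnramifiedImpactedBuilding (bruhatTitsTree K L) (unramifiedBasin K L) (Nat.card 𝓀[K]) := by
  obtain ⟨v, hv⟩ := exists_treeVertex_isClassOf hO
  refine ⟨bruhatTitsTree_isHomogeneousTree hL hp, v, ?_⟩
  ext x
  constructor
  · exact fun hx => hx.eq hv
  · rintro rfl
    exact hv

end FieldBasins

/-! ### The basin in the split case -/

section SplitBasin

set_option linter.unusedSectionVars false

variable {K : Type*} [Field K] [ValuativeRel K] [TopologicalSpace K] [IsNonarchimedeanLocalField K]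
variable {L : Type*} [CommRing L] [Algebra K L]

theorem exists_coe_eq_zpow_iff {p : 𝒪[K]} (hp : Irreducible p) {n : ℤ} :
    (∃ a : 𝒪[K], (a : K) = (p : K) ^ n) ↔ 0 ≤ n := by
  have hp0 := coe_ne_zero_of_irreducible hp
  constructor
  · rintro ⟨a, ha⟩
    by_contra! hn
    obtain ⟨m, hm⟩ := Int.eq_succ_of_zero_lt (neg_pos.2 hn)
    obtain rfl : n = -((m + 1 : ℕ) : ℤ) := by push_cast; omega
    rw [zpow_neg, zpow_natCast] at ha
    refine hp.not_isUnit (IsUnit.of_mul_eq_one (p ^ m * a) (Subtype.ext ?_))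
    change (p : K) * ((p : K) ^ m * (a : K)) = 1
    rw [ha, ← mul_assoc, ← pow_succ', mul_inv_cancel₀ (pow_ne_zero _ hp0)]
  · intro hn
    obtain ⟨m, rfl⟩ := Int.eq_ofNat_of_zero_le hn
    exact ⟨p ^ m, by rw [zpow_natCast]; rfl⟩

variable (hL : Module.finrank K L = 2) {p : 𝒪[K]} (hp : Irreducible p) (e : L ≃ₐ[K] K × K)

/-- The lattice `(1, 0) 𝒪[K] ⊕ (0, pᵐ) 𝒪[K]`. -/
def apartmentLattice (p : 𝒪[K]) (e : L ≃ₐ[K] K × K) (m : ℤ) : Submodule 𝒪[K] L :=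
  Submodule.span 𝒪[K] {e.symm (1, 0), e.symm (0, (p : K) ^ m)}

theorem mem_apartmentLattice_iff {m : ℤ} {x y : K} :
    e.symm (x, y) ∈ apartmentLattice p e m ↔
      (∃ a : 𝒪[K], (a : K) = x) ∧ ∃ b : 𝒪[K], (b : K) * (p : K) ^ m = y := by
  rw [apartmentLattice, Submodule.mem_span_pair]
  simp_rw [← symm_prod_smul, mul_one, EmbeddingLike.apply_eq_iff_eq, Prod.mk.injEq]
  constructor
  · rintro ⟨a, b, ha, hb⟩
    exact ⟨⟨a, ha⟩, b, hb⟩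
  · rintro ⟨⟨a, ha⟩, b, hb⟩
    exact ⟨a, b, ha, hb⟩

include hp

theorem isFrame_apartmentLattice (m : ℤ) :
    IsFrame (e.symm (1, 0)) (e.symm (0, (p : K) ^ m)) (apartmentLattice p e m) := by
  refine ⟨?_, rfl⟩
  have hp0 := zpow_ne_zero m (coe_ne_zero_of_irreducible hp)
  rw [LinearIndependent.pair_iff]
  intro s t h
  rw [← map_smul, ← map_smul, ← map_add, EmbeddingLike.map_eq_zero_iff] at h
  simpa [hp0] using h

include hL

theorem splitBasin_eq_stableVertices (hO : (Subalgebra.toSubmodule (integers K L)).IsLattice K)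
    {Δ : L} (hΔ : Algebra.adjoin 𝒪[K] {Δ} = integers K L) :
    splitBasin p e = stableVertices Δ := by
  have hp0 := coe_ne_zero_of_irreducible hp
  have hframe := isFrame_one_of_adjoin_eq hL hO hΔ
  ext v
  constructor
  · rintro ⟨m, hv⟩
    obtain ⟨a, b, hab⟩ := (isIntegral_iff_mem_prod e).1 hframe.right_mem
    obtain rfl : Δ = e.symm ((a : K), (b : K)) := by rw [← hab, AlgEquiv.symm_apply_apply]
    refine ⟨_, hv, fun x hx => ?_⟩
    change _ ∈ apartmentLattice p e m
    obtain ⟨⟨y, z⟩, rfl⟩ := e.symm.surjective x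
    obtain ⟨⟨c, rfl⟩, d, rfl⟩ := (mem_apartmentLattice_iff e).1 hx
    rw [← map_mul, Prod.mk_mul_mk, mem_apartmentLattice_iff]
    exact ⟨⟨a * c, rfl⟩, b * d, mul_assoc _ _ _⟩
  · intro hv
    obtain ⟨x, hx, hv⟩ := (mem_stableVertices_iff_exists_isUnit hL hO hΔ hp).1 hv
    obtain ⟨⟨y, z⟩, rfl⟩ := e.symm.surjective x
    -- `x 𝒪_L` consists of the elements `(a y, b z)` with integral `a` and `b`
    have hmem : ∀ w : L, w ∈ Submodule.span 𝒪[K] {e.symm (y, z), Δ * e.symm (y, z)} ↔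
        ∃ a b : 𝒪[K], e.symm ((a : K) * y, (b : K) * z) = w := by
      intro w
      have h1 : w ∈ Submodule.span 𝒪[K] {e.symm (y, z), Δ * e.symm (y, z)} ↔
          ∃ o ∈ Subalgebra.toSubmodule (integers K L), o * e.symm (y, z) = w := by
        rw [Submodule.mem_span_pair]
        constructor
        · rintro ⟨a, b, rfl⟩
          refine ⟨_, hframe.mem_iff.2 ⟨a, b, rfl⟩, ?_⟩
          rw [add_mul, smul_mul_assoc a, one_mul, smul_mul_assoc b]
        · rintro ⟨o, ho, rfl⟩
          obtain ⟨a, b, rfl⟩ := hframe.mem_iff.1 ho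
          refine ⟨a, b, ?_⟩
          rw [add_mul, smul_mul_assoc a, one_mul, smul_mul_assoc b]
      rw [h1]
      constructor
      · rintro ⟨o, ho, rfl⟩
        obtain ⟨a, b, hab⟩ := (isIntegral_iff_mem_prod e).1 ho
        refine ⟨a, b, ?_⟩
        rw [AlgEquiv.symm_apply_eq, map_mul, hab, AlgEquiv.apply_symm_apply, Prod.mk_mul_mk]
      · rintro ⟨a, b, rfl⟩
        refine ⟨e.symm ((a : K), (b : K)), (isIntegral_iff_mem_prod e).2
          ⟨a, b, AlgEquiv.apply_symm_apply _ _⟩, ?_⟩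
        rw [← map_mul, Prod.mk_mul_mk]
    have hyz : IsUnit ((y, z) : K × K) := by
      have := hx.map e
      rwa [AlgEquiv.apply_symm_apply] at this
    obtain ⟨hy, hz⟩ := Prod.isUnit_iff.1 hyz
    replace hy : y ≠ 0 := hy.ne_zero
    replace hz : z ≠ 0 := hz.ne_zero
    obtain ⟨m, u, hm⟩ := exists_zpow_mul_unit hp (div_ne_zero hz hy)
    have hz' : z = y * ((p : K) ^ m * ((u : 𝒪[K]) : K)) := by rw [← hm, mul_div_cancel₀ z hy]
    have hu : ((u : 𝒪[K]) : K) * (((u⁻¹ : 𝒪[K]ˣ) : 𝒪[K]) : K) = 1 :=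
      congrArg Subtype.val (Units.mul_inv u)
    refine ⟨m, TreeVertex.IsClassOf.of_smul hy ?_⟩
    convert hv using 1
    ext w
    change w ∈ y • apartmentLattice p e m ↔ _
    obtain ⟨⟨s, t⟩, rfl⟩ := e.symm.surjective w
    rw [hmem, mem_smul_iff hy, ← map_smul, Prod.smul_mk, mem_apartmentLattice_iff]
    simp only [EmbeddingLike.apply_eq_iff_eq, Prod.mk.injEq, smul_eq_mul]
    constructor
    · rintro ⟨⟨a, ha⟩, b, hb⟩
      refine ⟨a, b * ↑u⁻¹, ?_, ?_⟩
      · rw [ha, mul_comm, mul_inv_cancel_left₀ hy]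
      · have ht : t = y * ((b : K) * (p : K) ^ m) := by rw [hb, mul_inv_cancel_left₀ hy]
        change (b : K) * (((u⁻¹ : 𝒪[K]ˣ) : 𝒪[K]) : K) * z = t
        rw [ht, hz']
        linear_combination (b : K) * y * (p : K) ^ m * hu
    · rintro ⟨a, b, rfl, rfl⟩
      refine ⟨⟨a, by rw [mul_comm, mul_inv_cancel_right₀ hy]⟩, b * u, ?_⟩
      change (b : K) * ((u : 𝒪[K]) : K) * _ = _
      rw [hz']
      field_simp

theorem isSplitImpactedBuilding_splitBasin :
    IsSplitImpactedBuilding (bruhatTitsTree K L) (splitBasin p e) (Nat.card 𝓀[K]) := by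
  have hp0 := coe_ne_zero_of_irreducible hp
  have hlat := fun m => (isFrame_apartmentLattice hp e m).isLattice hL
  choose f hf using fun m => exists_treeVertex_isClassOf (hlat m)
  refine ⟨bruhatTitsTree_isHomogeneousTree hL hp, f, ?_, ?_, ?_⟩
  · intro i j hij
    obtain ⟨n, hn⟩ := (hf i).exists_zpow_smul hp (hij ▸ hf j)
    have key : ∀ x y : K, e.symm (x, y) ∈ apartmentLattice p e j ↔
        e.symm ((p : K) ^ (-n) * x, (p : K) ^ (-n) * y) ∈ apartmentLattice p e i := by
      intro x y
      rw [hn, mem_smul_iff (zpow_ne_zero n hp0), ← map_smul, zpow_neg]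
      rfl
    simp only [mem_apartmentLattice_iff] at key
    have key0 : ∀ m : ℤ, (∃ b : 𝒪[K], (b : K) * (p : K) ^ m = 0) := fun m =>
      ⟨0, by simp⟩
    have key1 : ∀ m k : ℤ, (∃ b : 𝒪[K], (b : K) * (p : K) ^ m = (p : K) ^ k) ↔ m ≤ k := by
      intro m k
      rw [← sub_nonneg, ← exists_coe_eq_zpow_iff hp]
      refine exists_congr fun b => ?_
      rw [zpow_sub₀ hp0, eq_div_iff (zpow_ne_zero m hp0)]
    have hx := fun k : ℤ => key ((p : K) ^ k) 0
    have hy := fun k : ℤ => key 0 ((p : K) ^ k)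
    have hzero : ∃ a : 𝒪[K], (a : K) = 0 := ⟨0, rfl⟩
    simp only [mul_zero, key0, and_true, ← zpow_add₀ hp0, exists_coe_eq_zpow_iff hp] at hx
    simp only [mul_zero, hzero, true_and, ← zpow_add₀ hp0, key1] at hy
    -- the cases `k = 0`, `k = n` of `hx` give `n = 0`, the other two give `i = j`
    have h1 := hx 0
    have h2 := hx n
    have h3 := hy j
    have h4 := hy (i + n)
    omega
  · intro i
    have h := isFrame_apartmentLattice hp e i
    refine (adj_lineLattice hL hp (hlat i) (k := 0) h.left_mem (h.left_notMem hp) ?_ ?_).symm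
    · convert hf (i + 1) using 1
      rw [(h.lineLattice hp 1).eq_span, apartmentLattice]
      congr 2
      rw [pow_one, zpow_add₀ hp0, zpow_one, mul_comm]
      change _ = {e.symm ((0 : K), (p : K) * (p : K) ^ i)}
      rw [← mul_zero (p : K), ← smul_eq_mul, ← smul_eq_mul, ← Prod.smul_mk, map_smul, smul_zero]
      rfl
    · rw [lineLattice_zero p h.left_mem]
      exact hf i
  · ext v
    constructor
    · rintro ⟨m, hv⟩
      exact ⟨m, (hf m).eq hv⟩
    · rintro ⟨m, rfl⟩
      exact ⟨m, hf m⟩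

end SplitBasin

theorem mainTheorem2
    (K : Type*) [Field K] [ValuativeRel K] [TopologicalSpace K] [IsNonarchimedeanLocalField K]
    [CharZero K]
    (L : Type*) [CommRing L] [IsReduced L] [Algebra K L] (hL : Module.finrank K L = 2) :
    (IsRamifiedCase K L ∨ IsUnramifiedCase K L ∨ IsSplitCase K L) ∧
    (∃ Δ : L, Algebra.adjoin 𝒪[K] {Δ} = integers K L) ∧
    ∀ p : 𝒪[K], Irreducible p → ∀ Δ : L, Algebra.adjoin 𝒪[K] {Δ} = integers K L →
      (IsRamifiedCase K L → ∀ π : integers K L, Irreducible π →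
        IsRamifiedImpactedBuilding (bruhatTitsTree K L) (ramifiedBasin π) (Nat.card 𝓀[K]) ∧
        ∀ (n : ℕ) (v : TreeVertex K L), RepresentsPrincipalIdeal (mainOrder p Δ n) v ↔
          v ∈ layer (bruhatTitsTree K L) (ramifiedBasin π) n) ∧
      (IsUnramifiedCase K L →
        IsUnramifiedImpactedBuilding (bruhatTitsTree K L) (unramifiedBasin K L) (Nat.card 𝓀[K]) ∧
        ∀ (n : ℕ) (v : TreeVertex K L), RepresentsPrincipalIdeal (mainOrder p Δ n) v ↔
          v ∈ layer (bruhatTitsTree K L) (unramifiedBasin K L) n) ∧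
      (∀ e : L ≃ₐ[K] K × K,
        IsSplitImpactedBuilding (bruhatTitsTree K L) (splitBasin p e) (Nat.card 𝓀[K]) ∧
        ∀ (n : ℕ) (v : TreeVertex K L), RepresentsPrincipalIdeal (mainOrder p Δ n) v ↔
          v ∈ layer (bruhatTitsTree K L) (splitBasin p e) n) := by
  have hO : (Subalgebra.toSubmodule (integers K L)).IsLattice K := by
    by_cases hF : IsField L
    · exact isLattice_integers_of_isField hL hF
    · obtain ⟨e⟩ := isSplitCase_of_not_isField hL hF
      exact (isFrame_split e).isLattice hL
  refine ⟨?_, exists_adjoin_eq_integers hL hO, fun p hp Δ hΔ => ⟨?_, ?_, ?_⟩⟩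
  · by_cases hF : IsField L
    · have := hF.isDomain
      have := isDiscreteValuationRing_integers hL hF hO
      obtain ⟨p, hp⟩ := IsDiscreteValuationRing.exists_irreducible 𝒪[K]
      obtain ⟨ϖ, hϖ⟩ := IsDiscreteValuationRing.exists_irreducible (integers K L)
      obtain ⟨j, hj0, hj2, -, hj⟩ := exists_associated_pow hL hO hp hϖ
      obtain rfl | rfl : j = 1 ∨ j = 2 := by omega
      · exact Or.inr (Or.inl ⟨hF, hj⟩)
      · exact Or.inl ⟨hF, fun P hP => by rw [hj P hP]; exact one_lt_two⟩
    · exact Or.inr (Or.inr (isSplitCase_of_not_isField hL hF))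
  · rintro ⟨hF, hram⟩ π hπ
    have := hF.isDomain
    have := isDiscreteValuationRing_integers hL hF hO
    obtain ⟨j, hj0, hj2, hassoc, hj⟩ := exists_associated_pow hL hO hp hπ
    have h1 := hram _ (IsLocalRing.maximalIdeal.isMaximal (integers K L))
    rw [hj _ (IsLocalRing.maximalIdeal.isMaximal (integers K L))] at h1
    obtain rfl : j = 2 := by omega
    exact ⟨isRamifiedImpactedBuilding_ramifiedBasin hL hO hp hπ hassoc,
      representsPrincipalIdeal_iff_mem_layer hL hO hΔ hp
        (ramifiedBasin_eq_stableVertices hL hO hp hπ hΔ hassoc)⟩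
  · rintro ⟨hF, hunram⟩
    have := hF.isDomain
    have := isDiscreteValuationRing_integers hL hF hO
    obtain ⟨ϖ, hϖ⟩ := IsDiscreteValuationRing.exists_irreducible (integers K L)
    obtain ⟨j, hj0, hj2, hassoc, hj⟩ := exists_associated_pow hL hO hp hϖ
    have h1 := hunram _ (IsLocalRing.maximalIdeal.isMaximal (integers K L))
    rw [hj _ (IsLocalRing.maximalIdeal.isMaximal (integers K L))] at h1
    subst h1
    exact ⟨isUnramifiedImpactedBuilding_unramifiedBasin hL hO hp,
      representsPrincipalIdeal_iff_mem_layer hL hO hΔ hp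
        (unramifiedBasin_eq_stableVertices hL hO hp hϖ hΔ hassoc)⟩
  · intro e
    exact ⟨isSplitImpactedBuilding_splitBasin hL hp e,
      representsPrincipalIdeal_iff_mem_layer hL hO hΔ hp
        (splitBasin_eq_stableVertices hL hp e hO hΔ)⟩

end
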